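/- **Setting.** Let $\mathcal Q=\{p_\theta(y)=\exp(\theta y-F(\theta)+r(y))\}$, $\theta\in\bar\Theta=\{\theta:F(\theta)<\infty\}$, be a univariate exponential family of densities on $\mathbb R$ relative to a fixed measure, let $\mu(\theta)=\mathbf E_{p_\theta}[Y]$, and call the set of all means of members of $\mathcal Q$ the mean-value parameter space. Let $g$ be a link function, continuous and injective on an open interval. Let $D\in\mathbb N\cup\{\infty\}$ and $\mathcal X\subseteq\mathbb R^{D}$; for $x\in\mathcal X$ write $x\rfloor_d$ for its first $d$ components. Let $M\in\mathbb N\cup\{\infty\}$, and let $\mathcal F_1\subseteq\mathcal F_2\subseteq\cdots$ be $M$ nested generalized linear models $$\mathcal F_j=\{p_\beta:\beta\in\mathcal B_j\},\qquad p_\beta(y\mid x)=\exp\bigl(\theta_x(\beta)y-F(\theta_x(\beta))+r(y)\bigr),\qquad \theta_x(\beta)=\mu^{-1}\bigl(g^{-1}(\langle\beta,x\rfloor_{d_j}\rangle)\bigr),$$ with convex measurable $\mathcal B_j\subseteq\mathbb R^{d_j}$ and $d_1<d_2<\cdots$, all $d_j\le D$; the case $M=1$ is a single GLM. Let $\mathcal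 F=\bigcup_j\mathcal F_j$, let $\ell_f(x,y)=-\log p_f(y\mid x)$ be the log loss, and let $Z=(X,Y)$, $Z_1,Z_2,\dots$ be i.i.d. with law $P$ on $\mathcal X\times\mathbb R$. Assume: 1. For all $j$, $\beta\in\mathcal B_j$ and $x\in\mathcal X$, $\langle\beta,x\rfloor_{d_j}\rangle$ is in the range of $g$. For each $j$ the map $(\beta,x)\mapsto g^{-1}(\langle\beta,x\rfloor_{d_j}\rangle)$ on $\mathcal B_j\times\mathcal X$ has a bounded derivative with respect to $\beta$. All its values, for all $j$ together, lie in one compact interval $[a,b]$, $a<b$, contained in the interior of the mean-value parameter space. 2. There are $\eta>0$ and $C<\infty$ with $\mathbf E[e^{\eta|Y|}\mid X=x]\le C$ for almost all $x$. 3. There are $j$ and $\beta^\circ\in\mathcal B_j$ with $\mathbf E[Y\mid X]=g^{-1}(\langle\beta^\circ,X\rfloor_{d_j}\rangle)$ almost surely. Let $\Pi_0$ be a hierarchical prior: draw $j$ from a probability mass function $\pi'$ with $\pi'(j)>0$ for every $j$, then draw $\beta\in\mathcal B_j$ from a probability density $\pi^{(j)}$ (relative to Lebesgue measure on $\mathcal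 B_j$) that is bounded away from $0$. The $\eta$-generalized Bayesian posterior $\Pi^B_n$ has density proportional to $\exp(-\eta\sum_{i=1}^n\ell_f(Z_i))$ relative to $\Pi_0$, and for $f^*\in\mathcal F$ $$\mathrm{IC}_{n,\eta}(f^*\|\Pi^B)=\mathbf E_{f\sim\Pi^B_n}\Bigl[\tfrac1n\sum_{i=1}^n\bigl(\ell_f(Z_i)-\ell_{f^*}(Z_i)\bigr)\Bigr]+\frac{\mathrm{KL}(\Pi^B_n\|\Pi_0)}{\eta n}.$$ A sequence is $\tilde O(1/n)$ if it is $O((\log n)^k/n)$ for some $k$. Call $f^*\in\mathcal F$ optimal if $\mathbf E[\ell_f-\ell_{f^*}]$ exists and is $\ge0$ for all $f\in\mathcal F$. The $\bar\eta$-central condition says that for some $f^*\in\mathcal F$, $\mathbf E[e^{-\bar\eta(\ell_f-\ell_{f^*})}]\le1$ for all $f\in\mathcal F$. **Proposition.** An optimal $f^*\in\mathcal F$ exists, and the $\bar\eta$-central condition holds for some $\bar\eta>0$. For every optimal $f^*$ and every fixed $\eta>0$, the posterior is well defined and the information complexity is finite almost surely and integrable for every $n\ge1$, and its expectation has an upper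 bound of order $\tilde O(1/n)$, i.e. $$\max\bigl\{\mathbf E[\mathrm{IC}_{n,\eta}(f^*\|\Pi^B)],0\bigr\}=\tilde O(1/n).$$ If moreover $0<\eta\le\bar\eta$ for some $\bar\eta$ for which the $\bar\eta$-central condition holds, then $\mathbf E[\mathrm{IC}_{n,\eta}(f^*\|\Pi^B)]=\tilde O(1/n)$, in absolute value. -/

import Mathlib

open MeasureTheory ProbabilityTheory Filter
open scoped ENNReal

namespace GLMIC

noncomputable section

/-! ### Learning problems: central condition, generalized Bayes, information complexity -/

section Learning

variable {Θ Z : Type*} [MeasurableSpace Θ] [MeasurableSpace Z]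

/-- `f₀` is a risk minimizer over the class `F`: it lies in `F`, and for every `f ∈ F` the excess
loss of `f` over `f₀` is integrable with nonnegative expectation. -/
def IsOptimal (P : Measure Z) (loss : Θ → Z → ℝ) (F : Set Θ) (f₀ : Θ) : Prop :=
  f₀ ∈ F ∧ ∀ f ∈ F, Integrable (fun z => loss f z - loss f₀ z) P ∧
    0 ≤ ∫ z, (loss f z - loss f₀ z) ∂P

/-- The strong `η`-central condition for the learning problem `(P, loss, F)`. -/
def CentralCondition (P : Measure Z) (loss : Θ → Z → ℝ) (F : Set Θ) (η : ℝ) : Prop :=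
  ∃ f₀ ∈ F, ∀ f ∈ F,
    ∫⁻ z, ENNReal.ofReal (Real.exp (-η * (loss f z - loss f₀ z))) ∂P ≤ 1

/-- The `η`-generalized Bayesian posterior based on the prior `prior` and the sample `z`: its
density relative to the prior is proportional to `exp (-η ∑ᵢ loss_f (zᵢ))`. -/
def genBayes (loss : Θ → Z → ℝ) (prior : Measure Θ) (η : ℝ) {n : ℕ} (z : Fin n → Z) :
    Measure Θ :=
  prior.tilted (fun f => -η * ∑ i, loss f (z i))

/-- Average excess loss of `f` over `f₀` on the sample `z`. -/
def empiricalExcess (loss : Θ → Z → ℝ) (f₀ : Θ) {n : ℕ} (z : Fin n → Z) (f : Θ) : ℝ :=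
  (1 / (n : ℝ)) * ∑ i, (loss f (z i) - loss f₀ (z i))

/-- Information complexity, relative to the comparator `f₀` and the prior `prior`, of a learning
algorithm that outputs the distribution `post` on the sample `z`. -/
def infoComplexity (loss : Θ → Z → ℝ) (prior : Measure Θ) (η : ℝ) (f₀ : Θ) {n : ℕ}
    (post : Measure Θ) (z : Fin n → Z) : ℝ :=
  (∫ f, empiricalExcess loss f₀ z f ∂post) +
    (InformationTheory.klDiv post prior).toReal / (η * n)

/-- Information complexity of the `η`-generalized Bayesian estimator, as a function of the
sample. -/
def bayesIC (loss : Θ → Z → ℝ) (prior : Measure Θ) (η : ℝ) (f₀ : Θ) (n : ℕ)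
    (z : Fin n → Z) : ℝ :=
  infoComplexity loss prior η f₀ (genBayes loss prior η z) z

/-- Expected information complexity of the `η`-generalized Bayesian estimator for `n` i.i.d.
observations from `P`. -/
def expectedBayesIC (P : Measure Z) (loss : Θ → Z → ℝ) (prior : Measure Θ) (η : ℝ) (f₀ : Θ)
    (n : ℕ) : ℝ :=
  ∫ z, bayesIC loss prior η f₀ n z ∂(Measure.pi (fun _ : Fin n => P))

/-- Nothing in `expectedBayesIC` takes a default value: almost surely the normalizing constant of
the posterior is finite, the excess loss is integrable under the posterior and the
Kullback-Leibler term is finite; and the information complexity is an integrable function of the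
sample. -/
def BayesICWellDefined (P : Measure Z) (loss : Θ → Z → ℝ) (prior : Measure Θ) (η : ℝ) (f₀ : Θ)
    (n : ℕ) : Prop :=
  (∀ᵐ z ∂(Measure.pi (fun _ : Fin n => P)),
    Integrable (fun f => Real.exp (-η * ∑ i, loss f (z i))) prior ∧
    Integrable (empiricalExcess loss f₀ z) (genBayes loss prior η z) ∧
    InformationTheory.klDiv (genBayes loss prior η z) prior ≠ ∞) ∧
  Integrable (bayesIC loss prior η f₀ n) (Measure.pi (fun _ : Fin n => P))

end Learning

/-- `u = Õ(v)`: `u` is big-O of `v` times some power of `log n`. -/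
def IsSoftO (u v : ℕ → ℝ) : Prop :=
  ∃ k : ℕ, u =O[atTop] (fun n : ℕ => v n * Real.log n ^ k)

/-! ### Univariate exponential families -/

/-- A univariate exponential family with densities `exp (θ y - F θ + r y)` relative to `base`. -/
structure ExpFamily where
  base : Measure ℝ
  r : ℝ → ℝ
  measurable_r : Measurable r

namespace ExpFamily

variable (Q : ExpFamily)

/-- The normalizing integral `∫ exp (θ y + r y) d(base)`. -/
def partition (θ : ℝ) : ℝ≥0∞ := ∫⁻ y, ENNReal.ofReal (Real.exp (θ * y + Q.r y)) ∂Q.base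

/-- The natural parameter space. -/
def naturalSpace : Set ℝ := {θ | Q.partition θ < ∞}

/-- The log-normalizer `F`. -/
def logNormalizer (θ : ℝ) : ℝ := Real.log (Q.partition θ).toReal

def density (θ y : ℝ) : ℝ := Real.exp (θ * y - Q.logNormalizer θ + Q.r y)

def law (θ : ℝ) : Measure ℝ := Q.base.withDensity (fun y => ENNReal.ofReal (Q.density θ y))

/-- Natural parameters of the members of the family whose mean exists. -/
def meanDomain : Set ℝ := {θ ∈ Q.naturalSpace | Integrable (fun y => y) (Q.law θ)}

/-- The mean `μ(θ)`. -/
def mean (θ : ℝ) : ℝ := ∫ y, y ∂(Q.law θ)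

/-- The mean-value parameter space. -/
def meanSpace : Set ℝ := Q.mean '' Q.meanDomain

/-- `μ⁻¹`, from mean-value parameters to natural parameters. -/
def invMean (m : ℝ) : ℝ := Function.invFunOn Q.mean Q.meanDomain m

end ExpFamily

/-! ### Generalized linear models -/

/-- The coordinates of `ℝ^D`, for a finite or infinite dimension `D`. -/
abbrev Coord (D : ℕ∞) : Type := {i : ℕ // (i : ℕ∞) < D}

/-- The indices `0, 1, …, M - 1` of a finite or countably infinite list of models. -/
abbrev ModelIndex (M : ℕ∞) : Type := {j : ℕ // (j : ℕ∞) < M}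

/-- The restriction of `x` to its first `d` components. -/
def truncate {D : ℕ∞} {d : ℕ} (h : (d : ℕ∞) ≤ D) (x : Coord D → ℝ) : Fin d → ℝ :=
  fun i => x ⟨i.1, lt_of_lt_of_le (Nat.cast_lt.mpr i.2) h⟩

/-- A list of `M` nested generalized linear models with common covariate set `𝒳 ⊆ ℝ^D`, common
exponential family and common link function. The link is a continuous injective function on an open
interval `linkDomain`; the `j`-th model has the convex parameter set `param j ⊆ ℝ^(dim j)`. -/
structure GLMSequence (D : ℕ∞) (𝒳 : Set (Coord D → ℝ)) (M : ℕ∞) where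
  family : ExpFamily
  link : ℝ → ℝ
  linkDomain : Set ℝ
  isOpen_linkDomain : IsOpen linkDomain
  ordConnected_linkDomain : linkDomain.OrdConnected
  continuousOn_link : ContinuousOn link linkDomain
  injOn_link : Set.InjOn link linkDomain
  dim : ModelIndex M → ℕ
  dim_strictMono : StrictMono dim
  dim_le : ∀ j, (dim j : ℕ∞) ≤ D
  param : ∀ j, Set (Fin (dim j) → ℝ)
  measurableSet_param : ∀ j, MeasurableSet (param j)
  convex_param : ∀ j, Convex ℝ (param j)

namespace GLMSequence

variable {D : ℕ∞} {𝒳 : Set (Coord D → ℝ)} {M : ℕ∞} (G : GLMSequence D 𝒳 M)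

/-- The inverse link function `g⁻¹`, defined on `link '' linkDomain`. -/
def invLink (t : ℝ) : ℝ := Function.invFunOn G.link G.linkDomain t

/-- The linear predictor: the inner product of `β` with the first `dim j` components of `x`. -/
def linPred (j : ModelIndex M) (β : Fin (G.dim j) → ℝ) (x : 𝒳) : ℝ :=
  ∑ i, β i * truncate (G.dim_le j) x.1 i

/-- The modelled conditional mean `g⁻¹(⟨β, x⟩)`. -/
def condMean (j : ModelIndex M) (β : Fin (G.dim j) → ℝ) (x : 𝒳) : ℝ :=
  G.invLink (G.linPred j β x)

/-- The natural parameter `θ_x(β) = μ⁻¹(g⁻¹(⟨β, x⟩))`. -/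
def natParam (j : ModelIndex M) (β : Fin (G.dim j) → ℝ) (x : 𝒳) : ℝ :=
  G.family.invMean (G.condMean j β x)

/-- The conditional density `p_β(y | x)`. -/
def condDensity (j : ModelIndex M) (β : Fin (G.dim j) → ℝ) (x : 𝒳) (y : ℝ) : ℝ :=
  G.family.density (G.natParam j β x) y

/-- The `j`-th model, as a set of conditional densities. -/
def model (j : ModelIndex M) : Set (𝒳 → ℝ → ℝ) :=
  {p | ∃ β ∈ G.param j, p = G.condDensity j β}

def IsNested : Prop := ∀ i j, i ≤ j → G.model i ⊆ G.model j

/-- Labels of predictors: a model index and a parameter vector of that model. -/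
abbrev Label : Type := Σ j : ModelIndex M, (Fin (G.dim j) → ℝ)

/-- The class of all predictors (the union of the models), as a set of labels. -/
def predictors : Set G.Label := {f | f.2 ∈ G.param f.1}

/-- The log loss `-log p_f(y | x)`. -/
def loss (f : G.Label) (z : 𝒳 × ℝ) : ℝ := -Real.log (G.condDensity f.1 f.2 z.1 z.2)

/-- Condition 1. Linear predictors lie in the range of the link. In each model, the inverse link
`(β, x) ↦ g⁻¹(⟨β, x⟩)` has bounded derivative in `β`. The image of the inverse link on all the
models together lies in a compact interval inside the interior of the mean-value parameter
space. -/
def Condition1 : Prop :=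
  (∀ j, ∀ β ∈ G.param j, ∀ x : 𝒳, G.linPred j β x ∈ G.link '' G.linkDomain) ∧
  (∀ j, ∃ C : ℝ, ∀ β ∈ G.param j, ∀ x : 𝒳,
    DifferentiableAt ℝ (fun b => G.condMean j b x) β ∧
    ‖fderiv ℝ (fun b => G.condMean j b x) β‖ ≤ C) ∧
  ∃ a b : ℝ, a < b ∧ Set.Icc a b ⊆ interior G.family.meanSpace ∧
    ∀ j, ∀ β ∈ G.param j, ∀ x : 𝒳, G.condMean j β x ∈ Set.Icc a b

/-- Condition 3: the conditional mean is well specified. -/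
def Condition3 (P : Measure (𝒳 × ℝ)) [IsFiniteMeasure P] : Prop :=
  ∃ j, ∃ β ∈ G.param j, ∀ᵐ x ∂P.fst, ∫ y, y ∂(P.condKernel x) = G.condMean j β x

/-- Ingredients of a hierarchical prior: a probability mass function with full support on the
models and, on each model, a probability density (relative to Lebesgue measure on the parameter
set) that is bounded away from `0`. -/
structure HierPrior where
  weight : PMF (ModelIndex M)
  weight_ne_zero : ∀ j, weight j ≠ 0
  dens : ∀ j, (Fin (G.dim j) → ℝ) → ℝ
  measurable_dens : ∀ j, Measurable (dens j)
  bddAway : ∀ j, ∃ c : ℝ, 0 < c ∧ ∀ β ∈ G.param j, c ≤ dens j β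
  lintegral_dens : ∀ j, ∫⁻ β in G.param j, ENNReal.ofReal (dens j β) = 1

variable {G}

/-- The prior within the `j`-th model. -/
def HierPrior.within (π : G.HierPrior) (j : ModelIndex M) : Measure (Fin (G.dim j) → ℝ) :=
  (volume.restrict (G.param j)).withDensity (fun β => ENNReal.ofReal (π.dens j β))

/-- The hierarchical prior: draw a model, then a parameter of that model. -/
def HierPrior.measure (π : G.HierPrior) : Measure G.Label :=
  Measure.sum (fun j => π.weight j • (π.within j).map (Sigma.mk j))

end GLMSequence

/-- Condition 2: exponential moments of `Y` given `X = x`, uniformly in `x`. -/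
def Condition2 {D : ℕ∞} {𝒳 : Set (Coord D → ℝ)} (P : Measure (𝒳 × ℝ)) [IsFiniteMeasure P] :
    Prop :=
  ∃ η : ℝ, 0 < η ∧ ∃ C : ℝ≥0∞, C < ∞ ∧
    ∀ᵐ x ∂P.fst, ∫⁻ y, ENNReal.ofReal (Real.exp (η * |y|)) ∂(P.condKernel x) ≤ C

end

end GLMIC

/-! The generalized posterior is a Gibbs measure, so its Kullback-Leibler term cancels the posterior
mean of the empirical excess loss. The information complexity is therefore exactly `-log W / (η n)`,
where `W` (`evidenceRatio`) is the prior average of `exp (-η ∑ᵢ excess lossᵢ)` (`bayesIC_eq`).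
Everything reduces to bounding `E[-log W]`.

Upper bound: keep in `W` only a ball of radius of order `1/n` around the comparator, inside its
model. There the excess loss is at most `O(1/n) (L + |Y|)`. By convexity of the parameter set, the
ball has prior mass at least `p n^(-d)` (`exists_prior_ball_ge`). This gives a bound of order `log n
/ n`.

Lower bound: under the central condition, independence gives `E W ≤ 1`, hence `E log W ≤ 0`
(`expectedBayesIC_nonneg`). If the comparator of the central condition is not the given optimal one,
the two expected complexities differ by an excess risk of known sign (`expectedBayesIC_sub`).

Optimality and the central condition come from strong convexity of the log-normalizer `F`. Relative
to a well-specified predictor with mean `m₀` and natural parameter `θ₀`, the conditional excess risk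
is the Bregman divergence `F θ - F θ₀ - m₀ (θ - θ₀) ≥ κ (θ - θ₀)²`. The noise contributes `(θ -
θ₀)(Y - m₀)`, whose exponential moment is at most `1 + c t²` at scale `t`; for a small rate the
divergence absorbs it.

The bounds are proved for a loss whose conditional means are clamped to `[a, b]`: it agrees with the
log loss on the predictors and is controlled at every label. -/

namespace GLMIC

/-! ### Exponential families: convexity of the log-normalizer and the inverse mean map -/

namespace ExpFamily

variable (Q : ExpFamily)

/-- The carrier measure `exp (r y) d(base)` of an exponential family. -/
noncomputable def carrier : Measure ℝ :=
  Q.base.withDensity (fun y => ENNReal.ofReal (Real.exp (Q.r y)))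

lemma measurable_exp_r : Measurable (fun y => ENNReal.ofReal (Real.exp (Q.r y))) :=
  (Real.measurable_exp.comp Q.measurable_r).ennreal_ofReal

lemma partition_eq (θ : ℝ) :
    Q.partition θ = ∫⁻ y, ENNReal.ofReal (Real.exp (θ * y)) ∂Q.carrier := by
  rw [carrier, lintegral_withDensity_eq_lintegral_mul _ Q.measurable_exp_r (by fun_prop)]
  refine lintegral_congr fun y => ?_
  rw [Pi.mul_apply, ← ENNReal.ofReal_mul (Real.exp_nonneg _), ← Real.exp_add, add_comm]

lemma mem_naturalSpace_iff {θ : ℝ} :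
    θ ∈ Q.naturalSpace ↔ Integrable (fun y => Real.exp (θ * y)) Q.carrier := by
  rw [naturalSpace, Set.mem_ofPred_eq, partition_eq, ← hasFiniteIntegral_iff_ofReal]
  · exact ⟨fun h => ⟨by fun_prop, h⟩, fun h => h.2⟩
  · exact Eventually.of_forall fun y => (Real.exp_pos _).le

lemma naturalSpace_eq : Q.naturalSpace = integrableExpSet id Q.carrier :=
  Set.ext fun _ => Q.mem_naturalSpace_iff

lemma logNormalizer_eq : Q.logNormalizer = cgf id Q.carrier := by
  ext θ
  rw [logNormalizer, cgf, mgf, partition_eq, integral_eq_lintegral_of_nonneg_ae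
    (Eventually.of_forall fun y => (Real.exp_pos _).le) (by fun_prop)]
  rfl

/-- Links the family to the calculus of cumulant generating functions: on the interior of the
natural space, `F` is analytic with the mean and the variance as its first two derivatives. -/
lemma law_eq_tilted [NeZero Q.carrier] {θ : ℝ} (hθ : θ ∈ Q.naturalSpace) :
    Q.law θ = Q.carrier.tilted (fun y => θ * y) := by
  have hpos : 0 < mgf id Q.carrier θ :=
    mgf_pos' (NeZero.ne _) (Q.mem_naturalSpace_iff.mp hθ)
  rw [law, Measure.tilted, carrier, ← withDensity_mul _ Q.measurable_exp_r (by fun_prop)]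
  congr 1
  ext y
  rw [Pi.mul_apply, ← ENNReal.ofReal_mul (Real.exp_nonneg _), density, logNormalizer_eq, cgf]
  congr 1
  rw [Real.exp_add, Real.exp_sub, Real.exp_log hpos, mul_comm]
  rfl

lemma isProbabilityMeasure_law [NeZero Q.carrier] {θ : ℝ} (hθ : θ ∈ Q.naturalSpace) :
    IsProbabilityMeasure (Q.law θ) := by
  rw [Q.law_eq_tilted hθ]
  exact isProbabilityMeasure_tilted (Q.mem_naturalSpace_iff.mp hθ)

/-- With a zero carrier every mean would be `0`, so two distinct means could not occur. -/
lemma carrier_neZero_of_meanSpace {a b : ℝ} (hab : a < b) (ha : a ∈ Q.meanSpace)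
    (hb : b ∈ Q.meanSpace) : NeZero Q.carrier := by
  refine ⟨fun h => hab.ne ?_⟩
  have hbase : Q.base = 0 := by
    rw [carrier, withDensity_eq_zero_iff Q.measurable_exp_r.aemeasurable] at h
    have : ∀ᵐ y ∂Q.base, False := h.mono fun y hy => by
      simp only [Pi.zero_apply, ENNReal.ofReal_eq_zero] at hy
      exact absurd (Real.exp_pos (Q.r y)) (not_lt.mpr hy)
    simpa using this
  have hmean (θ : ℝ) : Q.mean θ = 0 := by simp [mean, law, hbase]
  obtain ⟨θ, -, rfl⟩ := ha
  obtain ⟨θ', -, rfl⟩ := hb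
  rw [hmean, hmean]

/-- Gradient inequality for the log-normalizer. -/
lemma mean_mul_sub_le [NeZero Q.carrier] {θ θ' : ℝ} (hθ : θ ∈ Q.meanDomain)
    (hθ' : θ' ∈ Q.naturalSpace) :
    Q.mean θ * (θ' - θ) ≤ Q.logNormalizer θ' - Q.logNormalizer θ := by
  have hI := Q.mem_naturalSpace_iff.mp hθ.1
  have hI' := Q.mem_naturalSpace_iff.mp hθ'
  have := Q.isProbabilityMeasure_law hθ.1
  have hpos : 0 < mgf id Q.carrier θ := mgf_pos' (NeZero.ne _) hI
  have hpos' : 0 < mgf id Q.carrier θ' := mgf_pos' (NeZero.ne _) hI'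
  have hint : Integrable (fun y => Real.exp ((θ' - θ) * y)) (Q.law θ) := by
    rw [Q.law_eq_tilted hθ.1, integrable_tilted_iff hI]
    refine hI'.congr (Eventually.of_forall fun y => ?_)
    simp only [smul_eq_mul, ← Real.exp_add]
    ring_nf
  have hval : ∫ y, Real.exp ((θ' - θ) * y) ∂(Q.law θ) =
      Real.exp (Q.logNormalizer θ' - Q.logNormalizer θ) := by
    rw [Q.law_eq_tilted hθ.1, integral_exp_tilted, logNormalizer_eq, cgf, cgf, Real.exp_sub,
      Real.exp_log hpos, Real.exp_log hpos', mgf, mgf]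
    congr 1
    refine integral_congr_ae (Eventually.of_forall fun y => ?_)
    simp only [Pi.add_apply, id]
    ring_nf
  -- Jensen for `exp` under the law at `θ`, where `exp ((θ' - θ) y)` has mean `exp (F θ' - F θ)`.
  have hJ := convexOn_exp.map_integral_le (μ := Q.law θ) Real.continuous_exp.continuousOn
    isClosed_univ (f := fun y => (θ' - θ) * y) (by simp) (hθ.2.const_mul _) hint
  rw [hval, Real.exp_le_exp, integral_const_mul] at hJ
  rw [mean, mul_comm]
  exact hJ

/-- The gradient inequalities at the two points add up to `(μ θ - μ θ') (θ' - θ) ≤ 0`. -/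
lemma mean_monotoneOn [NeZero Q.carrier] : MonotoneOn Q.mean Q.meanDomain := by
  intro θ hθ θ' hθ' h
  rcases h.eq_or_lt with rfl | h
  · rfl
  have h1 := Q.mean_mul_sub_le hθ hθ'.1
  have h2 := Q.mean_mul_sub_le hθ' hθ.1
  by_contra! hc
  nlinarith

lemma convex_naturalSpace : Convex ℝ Q.naturalSpace := by
  rw [naturalSpace_eq]
  exact convex_integrableExpSet

lemma invMean_mem {m : ℝ} (hm : m ∈ Q.meanSpace) :
    Q.invMean m ∈ Q.meanDomain ∧ Q.mean (Q.invMean m) = m :=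
  ⟨Function.invFunOn_mem hm, Function.invFunOn_eq hm⟩

/-- Parameters with means `m ± ε / 2` bracket that of `m` strictly, by monotonicity of the mean, and
the natural space is convex. -/
lemma invMean_mem_interior [NeZero Q.carrier] {m : ℝ} (hm : m ∈ interior Q.meanSpace) :
    Q.invMean m ∈ interior Q.naturalSpace := by
  obtain ⟨hd, he⟩ := Q.invMean_mem (interior_subset hm)
  obtain ⟨ε, hε, hball⟩ := Metric.mem_nhds_iff.mp (mem_interior_iff_mem_nhds.mp hm)
  have h1 : m - ε / 2 ∈ Q.meanSpace := hball (by
    rw [Metric.mem_ball, Real.dist_eq, abs_lt]; constructor <;> linarith)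
  have h2 : m + ε / 2 ∈ Q.meanSpace := hball (by
    rw [Metric.mem_ball, Real.dist_eq, abs_lt]; constructor <;> linarith)
  obtain ⟨θ₁, hθ₁, e₁⟩ := h1
  obtain ⟨θ₂, hθ₂, e₂⟩ := h2
  have l1 : θ₁ < Q.invMean m := by
    by_contra! hc
    have := Q.mean_monotoneOn hd hθ₁ hc
    linarith
  have l2 : Q.invMean m < θ₂ := by
    by_contra! hc
    have := Q.mean_monotoneOn hθ₂ hd hc
    linarith
  rw [mem_interior_iff_mem_nhds]
  exact mem_of_superset (Icc_mem_nhds l1 l2) (Q.convex_naturalSpace.ordConnected.out hθ₁.1 hθ₂.1)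

lemma mean_eq_deriv [NeZero Q.carrier] {θ : ℝ} (hθ : θ ∈ interior Q.naturalSpace) :
    Q.mean θ = deriv Q.logNormalizer θ := by
  rw [mean, Q.law_eq_tilted (interior_subset hθ), logNormalizer_eq]
  rw [naturalSpace_eq] at hθ
  exact integral_tilted_mul_self (X := id) hθ

/-- The second derivative is the variance. If it vanished, the carrier would be concentrated at one
point, so every law in the family would have the same mean, against `a < b`. -/
lemma iteratedDeriv_two_logNormalizer_pos {a b : ℝ} (hab : a < b) (ha : a ∈ Q.meanSpace)
    (hb : b ∈ Q.meanSpace) {θ : ℝ} (hθ : θ ∈ interior Q.naturalSpace) :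
    0 < iteratedDeriv 2 Q.logNormalizer θ := by
  have := Q.carrier_neZero_of_meanSpace hab ha hb
  have hn := Q.mem_naturalSpace_iff.mp (interior_subset hθ)
  have := Q.isProbabilityMeasure_law (interior_subset hθ)
  have hlaw := Q.law_eq_tilted (interior_subset hθ)
  rw [naturalSpace_eq] at hθ
  rw [logNormalizer_eq, ← variance_tilted_mul hθ]
  refine lt_of_le_of_ne (variance_nonneg _ _) fun h0 => hab.ne ?_
  simp only [id] at h0
  rw [← hlaw] at h0
  have hL : MemLp id 2 (Q.law θ) := by
    rw [hlaw]
    exact memLp_tilted_mul (X := id) hθ 2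
  have hev := (evariance_eq_zero_iff hL.aemeasurable).mp
    (by rw [← hL.ofReal_variance_eq, ← h0, ENNReal.ofReal_zero])
  have hc : ∀ᵐ y ∂Q.carrier, y = Q.mean θ := by
    have hac : Q.carrier ≪ Q.law θ := by
      rw [hlaw]
      exact absolutelyContinuous_tilted hn
    exact hac.ae_le hev
  have hmean {θ' : ℝ} (hθ' : θ' ∈ Q.meanDomain) : Q.mean θ' = Q.mean θ := by
    have := Q.isProbabilityMeasure_law hθ'.1
    have hc' : ∀ᵐ y ∂Q.law θ', y = Q.mean θ := by
      rw [Q.law_eq_tilted hθ'.1]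
      exact (tilted_absolutelyContinuous _ _).ae_le hc
    rw [mean, integral_congr_ae hc']
    simp
  obtain ⟨θ₁, h₁, rfl⟩ := ha
  obtain ⟨θ₂, h₂, rfl⟩ := hb
  rw [hmean h₁, hmean h₂]

/-- Strong convexity of the log-normalizer on compact subintervals of the interior of the natural
parameter space. -/
lemma exists_strongConvexity {a b : ℝ} (hab : a < b) (ha : a ∈ Q.meanSpace)
    (hb : b ∈ Q.meanSpace) {s t : ℝ} (hst : s ≤ t)
    (hI : Set.Icc s t ⊆ interior Q.naturalSpace) :
    ∃ κ : ℝ, 0 < κ ∧ ∀ θ ∈ Set.Icc s t, ∀ θ' ∈ Set.Icc s t,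
      Q.mean θ * (θ' - θ) + κ * (θ' - θ) ^ 2 ≤ Q.logNormalizer θ' - Q.logNormalizer θ := by
  have := Q.carrier_neZero_of_meanSpace hab ha hb
  have hA : AnalyticOnNhd ℝ Q.logNormalizer (interior Q.naturalSpace) := by
    rw [naturalSpace_eq, logNormalizer_eq]
    exact analyticOnNhd_cgf
  have hcont : ContinuousOn (iteratedDeriv 2 Q.logNormalizer) (Set.Icc s t) :=
    ((hA.iterated_deriv 2).continuousOn.mono hI).congr fun x _ => by rw [iteratedDeriv_eq_iterate]
  obtain ⟨θ₀, hθ₀, hmin⟩ := isCompact_Icc.exists_isMinOn (Set.nonempty_Icc.mpr hst) hcont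
  -- Half the minimum of `F''`, so that `F - κ x²` is convex on the interval; the claim is its
  -- gradient inequality.
  set κ := iteratedDeriv 2 Q.logNormalizer θ₀ / 2 with hκ
  have hκpos : 0 < κ := half_pos (Q.iteratedDeriv_two_logNormalizer_pos hab ha hb (hI hθ₀))
  have hd1 (x) (hx : x ∈ Set.Icc s t) : HasDerivAt Q.logNormalizer (Q.mean x) x := by
    rw [Q.mean_eq_deriv (hI hx)]
    exact (hA x (hI hx)).differentiableAt.hasDerivAt
  have hd2 (x) (hx : x ∈ Set.Icc s t) :
      HasDerivAt (deriv Q.logNormalizer) (iteratedDeriv 2 Q.logNormalizer x) x := by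
    rw [iteratedDeriv_succ, iteratedDeriv_one]
    exact (hA.deriv x (hI hx)).differentiableAt.hasDerivAt
  have hmono : MonotoneOn (fun x => deriv Q.logNormalizer x - 2 * κ * x) (Set.Icc s t) := by
    have hd (x) (hx : x ∈ Set.Icc s t) : HasDerivAt (fun x => deriv Q.logNormalizer x - 2 * κ * x)
        (iteratedDeriv 2 Q.logNormalizer x - 2 * κ) x := by
      simpa using (hd2 x hx).fun_sub ((hasDerivAt_id x).const_mul (2 * κ))
    refine monotoneOn_of_deriv_nonneg (convex_Icc s t)
      (fun x hx => (hd x hx).continuousAt.continuousWithinAt)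
      (fun x hx => (hd x (interior_subset hx)).differentiableAt.differentiableWithinAt)
      fun x hx => ?_
    rw [(hd x (interior_subset hx)).deriv]
    have := hmin (interior_subset hx)
    simp only [Set.mem_ofPred_eq] at this
    linarith
  refine ⟨κ, hκpos, fun θ hθ θ' hθ' => ?_⟩
  have hg (x) (hx : x ∈ Set.Icc s t) :
      HasDerivAt (fun x => Q.logNormalizer x - κ * x ^ 2) (Q.mean x - 2 * κ * x) x := by
    have := (hd1 x hx).fun_sub ((hasDerivAt_pow 2 x).const_mul κ)
    simp only [Nat.cast_ofNat, Nat.add_one_sub_one, pow_one] at this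
    refine this.congr_deriv ?_
    ring
  have hgc : ContinuousOn (fun x => Q.logNormalizer x - κ * x ^ 2) (Set.Icc s t) :=
    fun x hx => (hg x hx).continuousAt.continuousWithinAt
  have hmono' (x) (hx : x ∈ Set.Icc s t) (y) (hy : y ∈ Set.Icc s t) (h : x ≤ y) :
      Q.mean x - 2 * κ * x ≤ Q.mean y - 2 * κ * y := by
    rw [Q.mean_eq_deriv (hI hx), Q.mean_eq_deriv (hI hy)]
    exact hmono hx hy h
  rcases lt_trichotomy θ θ' with h | rfl | h
  · obtain ⟨c, hc, hce⟩ := exists_hasDerivAt_eq_slope _ (fun x => Q.mean x - 2 * κ * x) h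
      (hgc.mono (Set.Icc_subset_Icc hθ.1 hθ'.2))
      (fun x hx => hg x ⟨hθ.1.trans hx.1.le, hx.2.le.trans hθ'.2⟩)
    have := hmono' θ hθ c ⟨hθ.1.trans hc.1.le, hc.2.le.trans hθ'.2⟩ hc.1.le
    rw [hce, le_div_iff₀ (sub_pos.mpr h)] at this
    nlinarith
  · simp
  · obtain ⟨c, hc, hce⟩ := exists_hasDerivAt_eq_slope _ (fun x => Q.mean x - 2 * κ * x) h
      (hgc.mono (Set.Icc_subset_Icc hθ'.1 hθ.2))
      (fun x hx => hg x ⟨hθ'.1.trans hx.1.le, hx.2.le.trans hθ.2⟩)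
    have := hmono' c ⟨hθ'.1.trans hc.1.le, hc.2.le.trans hθ.2⟩ θ hθ hc.2.le
    rw [hce, div_le_iff₀ (sub_pos.mpr h)] at this
    nlinarith

/-- The natural parameter with mean `m`, for `m` clamped to `[a, b]`. -/
noncomputable def clampedInvMean (a b m : ℝ) : ℝ := Q.invMean (max a (min b m))

lemma clampedInvMean_of_mem {a b m : ℝ} (hm : m ∈ Set.Icc a b) :
    Q.clampedInvMean a b m = Q.invMean m := by
  rw [clampedInvMean, min_eq_right hm.2, max_eq_right hm.1]

/-- Two-sided control of the clamped natural parameter and the log-normalizer. -/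
structure ClampedBounds (a b κ L : ℝ) : Prop where
  κ_pos : 0 < κ
  L_pos : 0 < L
  abs_sub_le : ∀ m m', |Q.clampedInvMean a b m - Q.clampedInvMean a b m'| ≤ L * |m - m'|
  abs_sub_le_const : ∀ m m', |Q.clampedInvMean a b m - Q.clampedInvMean a b m'| ≤ L
  abs_logNormalizer_sub_le : ∀ m m', |Q.logNormalizer (Q.clampedInvMean a b m)
      - Q.logNormalizer (Q.clampedInvMean a b m')|
    ≤ L * |Q.clampedInvMean a b m - Q.clampedInvMean a b m'|
  mul_sq_le : ∀ m₀ ∈ Set.Icc a b, ∀ m,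
    κ * (Q.clampedInvMean a b m - Q.clampedInvMean a b m₀) ^ 2 ≤
      Q.logNormalizer (Q.clampedInvMean a b m) - Q.logNormalizer (Q.clampedInvMean a b m₀)
        - m₀ * (Q.clampedInvMean a b m - Q.clampedInvMean a b m₀)

/-- All the bounds follow from strong convexity on the compact interval of parameters with means in
`[a, b]`. Used at both points, it makes the inverse mean map Lipschitz. Since the slope of `F` is
the mean, `F` is Lipschitz there with constant `max |a| |b|`. -/
lemma exists_clampedBounds {a b : ℝ} (hab : a < b)
    (h : Set.Icc a b ⊆ interior Q.meanSpace) : ∃ κ L : ℝ, Q.ClampedBounds a b κ L := by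
  have ha : a ∈ Set.Icc a b := Set.left_mem_Icc.mpr hab.le
  have hb : b ∈ Set.Icc a b := Set.right_mem_Icc.mpr hab.le
  have := Q.carrier_neZero_of_meanSpace hab (interior_subset (h ha)) (interior_subset (h hb))
  have hinv (m) (hm : m ∈ Set.Icc a b) := Q.invMean_mem (interior_subset (h hm))
  have hmono (m) (hm : m ∈ Set.Icc a b) (m') (hm' : m' ∈ Set.Icc a b) (hl : m ≤ m') :
      Q.invMean m ≤ Q.invMean m' := by
    rcases hl.eq_or_lt with rfl | hl
    · rfl
    by_contra! hc
    have := Q.mean_monotoneOn (hinv m' hm').1 (hinv m hm).1 hc.le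
    rw [(hinv m' hm').2, (hinv m hm).2] at this
    linarith
  have hmem (m) (hm : m ∈ Set.Icc a b) : Q.invMean m ∈ Set.Icc (Q.invMean a) (Q.invMean b) :=
    ⟨hmono a ha m hm hm.1, hmono m hm b hb hm.2⟩
  obtain ⟨κ, hκ, hsc⟩ := Q.exists_strongConvexity hab (interior_subset (h ha))
    (interior_subset (h hb)) (hmono a ha b hb hab.le)
    (Q.convex_naturalSpace.interior.ordConnected.out (Q.invMean_mem_interior (h ha))
      (Q.invMean_mem_interior (h hb)))
  have key (m) (hm : m ∈ Set.Icc a b) (m') (hm' : m' ∈ Set.Icc a b) :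
      m * (Q.invMean m' - Q.invMean m) + κ * (Q.invMean m' - Q.invMean m) ^ 2 ≤
        Q.logNormalizer (Q.invMean m') - Q.logNormalizer (Q.invMean m) := by
    have := hsc _ (hmem m hm) _ (hmem m' hm')
    rwa [(hinv m hm).2] at this
  have hcl (m : ℝ) : max a (min b m) ∈ Set.Icc a b :=
    ⟨le_max_left _ _, max_le hab.le (min_le_left _ _)⟩
  have hcllip (m m' : ℝ) : |max a (min b m) - max a (min b m')| ≤ |m - m'| := by
    rw [max_comm a, max_comm a]
    exact (abs_max_sub_max_le_abs _ _ _).trans (by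
      simpa [min_comm b] using abs_min_sub_min_le_max m b m' b)
  have hlip (m) (hm : m ∈ Set.Icc a b) (m') (hm' : m' ∈ Set.Icc a b) :
      κ * |Q.invMean m - Q.invMean m'| ≤ |m - m'| := by
    have h1 := key m hm m' hm'
    have h2 := key m' hm' m hm
    rcases (abs_nonneg (Q.invMean m - Q.invMean m')).eq_or_lt with h0 | h0
    · rw [← h0]; simp
    -- Sum of the two strong convexity inequalities, in which the log-normalizers cancel.
    have h3 : 2 * κ * |Q.invMean m - Q.invMean m'| ^ 2 ≤
        |m - m'| * |Q.invMean m - Q.invMean m'| := by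
      rw [sq_abs, ← abs_mul]
      refine le_trans ?_ (le_abs_self _)
      nlinarith
    nlinarith [mul_pos hκ h0]
  have hlip' (m m' : ℝ) : |Q.clampedInvMean a b m - Q.clampedInvMean a b m'| ≤ κ⁻¹ * |m - m'| := by
    rw [← div_eq_inv_mul, le_div_iff₀' hκ]
    exact (hlip _ (hcl m) _ (hcl m')).trans (hcllip m m')
  have hb2 (m m' : ℝ) :
      |Q.clampedInvMean a b m - Q.clampedInvMean a b m'| ≤ κ⁻¹ * (b - a) := by
    rw [← div_eq_inv_mul, le_div_iff₀' hκ]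
    refine (hlip _ (hcl m) _ (hcl m')).trans ?_
    rw [abs_le]
    have h1 := hcl m
    have h2 := hcl m'
    constructor <;> linarith [h1.1, h1.2, h2.1, h2.2]
  have hF (m m' : ℝ) : Q.logNormalizer (Q.clampedInvMean a b m)
      - Q.logNormalizer (Q.clampedInvMean a b m') ≤
        max |a| |b| * |Q.clampedInvMean a b m - Q.clampedInvMean a b m'| := by
    have h1 := key _ (hcl m) _ (hcl m')
    have h2 : |max a (min b m)| ≤ max |a| |b| := abs_le_max_abs_abs (hcl m).1 (hcl m).2
    have h3 : max a (min b m) * (Q.clampedInvMean a b m - Q.clampedInvMean a b m') ≤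
        max |a| |b| * |Q.clampedInvMean a b m - Q.clampedInvMean a b m'| := by
      refine (le_abs_self _).trans ?_
      rw [abs_mul]
      gcongr
    simp only [clampedInvMean] at *
    nlinarith [mul_nonneg hκ.le (sq_nonneg (Q.invMean (max a (min b m')) -
      Q.invMean (max a (min b m))))]
  have hp1 : 0 < κ⁻¹ := inv_pos.mpr hκ
  have hp2 : 0 < κ⁻¹ * (b - a) := mul_pos hp1 (sub_pos.mpr hab)
  have hp3 : 0 ≤ max |a| |b| := (abs_nonneg a).trans (le_max_left _ _)
  -- The sum dominates the Lipschitz constant, the diameter bound and the slope bound at once.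
  refine ⟨κ, κ⁻¹ + κ⁻¹ * (b - a) + max |a| |b|, hκ, by positivity, fun m m' => ?_,
    fun m m' => ?_, fun m m' => ?_, fun m₀ hm₀ m => ?_⟩
  · refine (hlip' m m').trans ?_
    gcongr
    linarith
  · exact (hb2 m m').trans (by linarith)
  · rw [abs_le']
    have hle : max |a| |b| * |Q.clampedInvMean a b m - Q.clampedInvMean a b m'| ≤
        (κ⁻¹ + κ⁻¹ * (b - a) + max |a| |b|) *
          |Q.clampedInvMean a b m - Q.clampedInvMean a b m'| := by
      gcongr
      linarith
    refine ⟨(hF m m').trans hle, le_trans ?_ hle⟩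
    rw [neg_sub, abs_sub_comm]
    exact hF m' m
  · have := key m₀ hm₀ _ (hcl m)
    rw [Q.clampedInvMean_of_mem hm₀]
    simp only [clampedInvMean]
    linarith

end ExpFamily

/-! ### Information complexity of the generalized posterior, for losses with an envelope -/

section GeneralizedBayes

set_option linter.unusedSectionVars false

variable {Θ Z : Type*} [MeasurableSpace Θ] [MeasurableSpace Z]
  {P : Measure Z} {prior : Measure Θ} {loss : Θ → Z → ℝ} {η : ℝ} {f₀ : Θ} {h : Z → ℝ} {n : ℕ}

/-- Prior average of the exponentiated cumulative excess loss. -/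
noncomputable def evidenceRatio (loss : Θ → Z → ℝ) (prior : Measure Θ) (η : ℝ) (f₀ : Θ)
    {n : ℕ} (z : Fin n → Z) : ℝ :=
  ∫ f, Real.exp (-η * ∑ i, (loss f (z i) - loss f₀ (z i))) ∂prior

lemma measurable_exp_excess (hloss : Measurable (fun p : Θ × Z => loss p.1 p.2)) (n : ℕ) :
    Measurable (fun p : (Fin n → Z) × Θ =>
      Real.exp (-η * ∑ i, (loss p.2 (p.1 i) - loss f₀ (p.1 i)))) := by
  refine Real.measurable_exp.comp (Measurable.const_mul (Finset.measurable_fun_sum _ fun i _ => ?_) _)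
  refine (hloss.comp (by fun_prop : Measurable fun p : (Fin n → Z) × Θ => (p.2, p.1 i))).sub
    (hloss.comp (by fun_prop : Measurable fun p : (Fin n → Z) × Θ => (f₀, p.1 i)))

lemma abs_sum_excess_le (hbd : ∀ f z, |loss f z - loss f₀ z| ≤ h z) (z : Fin n → Z) (f : Θ) :
    |∑ i, (loss f (z i) - loss f₀ (z i))| ≤ ∑ i, h (z i) :=
  (Finset.abs_sum_le_sum_abs _ _).trans (Finset.sum_le_sum fun i _ => hbd f (z i))

lemma integrable_exp_excess [IsFiniteMeasure prior]
    (hloss : Measurable (fun p : Θ × Z => loss p.1 p.2)) (hη : 0 < η)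
    (hbd : ∀ f z, |loss f z - loss f₀ z| ≤ h z) (z : Fin n → Z) :
    Integrable (fun f => Real.exp (-η * ∑ i, (loss f (z i) - loss f₀ (z i)))) prior := by
  refine Integrable.of_bound (C := Real.exp (η * ∑ i, h (z i)))
    (((measurable_exp_excess hloss n).comp (by fun_prop :
      Measurable fun f : Θ => (z, f))).aestronglyMeasurable) (Eventually.of_forall fun f => ?_)
  rw [Real.norm_eq_abs, Real.abs_exp, Real.exp_le_exp]
  nlinarith [neg_le_of_abs_le (abs_sum_excess_le hbd z f)]

/-- The integrand lies between `exp (± η ∑ h)` uniformly over the prior. The bound dominates the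
logarithm by an integrable function of the sample. -/
lemma abs_log_evidenceRatio_le [IsProbabilityMeasure prior]
    (hloss : Measurable (fun p : Θ × Z => loss p.1 p.2)) (hη : 0 < η)
    (hbd : ∀ f z, |loss f z - loss f₀ z| ≤ h z) (z : Fin n → Z) :
    0 < evidenceRatio loss prior η f₀ z ∧
      |Real.log (evidenceRatio loss prior η f₀ z)| ≤ η * ∑ i, h (z i) := by
  have hint := integrable_exp_excess (prior := prior) hloss hη hbd z
  have h1 : Real.exp (-(η * ∑ i, h (z i))) ≤ evidenceRatio loss prior η f₀ z := by
    have := integral_mono (μ := prior) (integrable_const (Real.exp (-(η * ∑ i, h (z i))))) hint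
      fun f => Real.exp_le_exp.mpr (by
        have := le_of_abs_le (abs_sum_excess_le hbd z f)
        nlinarith)
    rw [integral_const, probReal_univ, one_smul] at this
    exact this
  have h2 : evidenceRatio loss prior η f₀ z ≤ Real.exp (η * ∑ i, h (z i)) := by
    have := integral_mono (μ := prior) hint (integrable_const (Real.exp (η * ∑ i, h (z i))))
      fun f => Real.exp_le_exp.mpr (by
        have := neg_le_of_abs_le (abs_sum_excess_le hbd z f)
        nlinarith)
    rw [integral_const, probReal_univ, one_smul] at this
    exact this
  have hpos := (Real.exp_pos _).trans_le h1
  exact ⟨hpos, abs_le.mpr ⟨(Real.le_log_iff_exp_le hpos).mpr h1,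
    (Real.log_le_iff_le_exp hpos).mpr h2⟩⟩

/-- The information complexity of the generalized posterior is the normalized negative logarithm
of the evidence ratio. -/
lemma bayesIC_eq [IsProbabilityMeasure prior]
    (hloss : Measurable (fun p : Θ × Z => loss p.1 p.2)) (hη : 0 < η) (hn : 1 ≤ n)
    (hbd : ∀ f z, |loss f z - loss f₀ z| ≤ h z) (z : Fin n → Z) :
    Integrable (fun f => Real.exp (-η * ∑ i, loss f (z i))) prior ∧
    Integrable (empiricalExcess loss f₀ z) (genBayes loss prior η z) ∧
    InformationTheory.klDiv (genBayes loss prior η z) prior ≠ ∞ ∧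
    bayesIC loss prior η f₀ n z = -Real.log (evidenceRatio loss prior η f₀ z) / (η * n) := by
  set s₀ := ∑ i, loss f₀ (z i) with hs₀
  set g : Θ → ℝ := fun f => -η * ∑ i, loss f (z i) with hg
  have hn0 : (0 : ℝ) < n := by exact_mod_cast hn
  have hgm : Measurable g := by
    refine Measurable.const_mul (Finset.measurable_fun_sum _ fun i _ => ?_) _
    exact hloss.comp (by fun_prop : Measurable fun f : Θ => (f, z i))
  have hexp (f : Θ) : Real.exp (g f) =
      Real.exp (-η * s₀) * Real.exp (-η * ∑ i, (loss f (z i) - loss f₀ (z i))) := by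
    rw [← Real.exp_add, Finset.sum_sub_distrib]
    congr 1
    ring
  have hint : Integrable (fun f => Real.exp (g f)) prior := by
    simp_rw [hexp]
    exact (integrable_exp_excess hloss hη hbd z).const_mul _
  have : IsProbabilityMeasure (genBayes loss prior η z) := isProbabilityMeasure_tilted hint
  have hac : genBayes loss prior η z ≪ prior := tilted_absolutelyContinuous _ _
  have hgint : Integrable g (genBayes loss prior η z) := by
    refine Integrable.of_bound (C := η * (∑ i, h (z i)) + |η * s₀|) hgm.aestronglyMeasurable
      (Eventually.of_forall fun f => ?_)
    have h1 := abs_sum_excess_le hbd z f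
    rw [Finset.sum_sub_distrib, ← hs₀] at h1
    have h2 : g f = -(η * ((∑ i, loss f (z i)) - s₀)) + -(η * s₀) := by
      simp only [hg]
      ring
    rw [Real.norm_eq_abs, h2]
    refine (abs_add_le _ _).trans ?_
    rw [abs_neg, abs_neg, abs_mul, abs_of_pos hη]
    gcongr
  have hemp : empiricalExcess loss f₀ z = fun f => (1 / (n : ℝ)) * (-(1 / η) * g f - s₀) := by
    ext f
    rw [empiricalExcess, Finset.sum_sub_distrib, ← hs₀]
    simp only [hg]
    field_simp
  -- The divergence is the posterior mean of `g` minus the log normalizing constant. The mean of `g`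
  -- cancels against the empirical excess, leaving `log W`.
  have hllr : llr (genBayes loss prior η z) prior =ᵐ[genBayes loss prior η z]
      fun f => g f - Real.log (∫ f, Real.exp (g f) ∂prior) :=
    hac.ae_le (log_rnDeriv_tilted_left_self hint)
  have hllrint : Integrable (llr (genBayes loss prior η z) prior) (genBayes loss prior η z) :=
    (hgint.sub (integrable_const _)).congr hllr.symm
  have hempint : Integrable (empiricalExcess loss f₀ z) (genBayes loss prior η z) := by
    rw [hemp]
    exact ((hgint.const_mul _).sub (integrable_const _)).const_mul _
  refine ⟨hint, hempint, InformationTheory.klDiv_ne_top hac hllrint, ?_⟩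
  have hlog : Real.log (∫ f, Real.exp (g f) ∂prior) =
      -η * s₀ + Real.log (evidenceRatio loss prior η f₀ z) := by
    simp_rw [hexp]
    rw [integral_const_mul, ← evidenceRatio, Real.log_mul (Real.exp_pos _).ne'
      (abs_log_evidenceRatio_le hloss hη hbd z).1.ne', Real.log_exp]
  rw [bayesIC, infoComplexity, InformationTheory.toReal_klDiv_of_measure_eq hac (by simp),
    integral_congr_ae hllr, integral_sub hgint (integrable_const _), integral_const, hemp,
    integral_const_mul, integral_sub (hgint.const_mul _) (integrable_const _), integral_const_mul,
    integral_const, hlog]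
  simp only [probReal_univ, one_smul]
  field_simp
  ring

lemma measurable_evidenceRatio [SFinite prior]
    (hloss : Measurable (fun p : Θ × Z => loss p.1 p.2)) :
    Measurable (fun z : Fin n → Z => evidenceRatio loss prior η f₀ z) :=
  ((measurable_exp_excess hloss n).stronglyMeasurable.integral_prod_right' (ν := prior)).measurable

lemma integrable_sum_eval [IsProbabilityMeasure P] (hh : Integrable h P) :
    Integrable (fun z : Fin n → Z => ∑ i, h (z i)) (Measure.pi fun _ => P) :=
  integrable_finsetSum _ fun i _ => integrable_comp_eval (i := i) hh

lemma integral_sum_eval [IsProbabilityMeasure P] (hh : Integrable h P) :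
    ∫ z : Fin n → Z, ∑ i, h (z i) ∂(Measure.pi fun _ => P) = n * ∫ z, h z ∂P := by
  rw [integral_finsetSum _ fun i _ => integrable_comp_eval (i := i) hh]
  simp [integral_comp_eval (μ := fun _ : Fin n => P) hh.aestronglyMeasurable]

lemma integrable_log_evidenceRatio [IsProbabilityMeasure P] [IsProbabilityMeasure prior]
    (hloss : Measurable (fun p : Θ × Z => loss p.1 p.2)) (hη : 0 < η)
    (hh : Integrable h P) (hbd : ∀ f z, |loss f z - loss f₀ z| ≤ h z) :
    Integrable (fun z : Fin n → Z => Real.log (evidenceRatio loss prior η f₀ z))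
      (Measure.pi fun _ => P) :=
  ((integrable_sum_eval hh).const_mul η).mono'
    (measurable_evidenceRatio hloss).log.aestronglyMeasurable
    (Eventually.of_forall fun z => (abs_log_evidenceRatio_le hloss hη hbd z).2)

lemma bayesICWellDefined_of_bound [IsProbabilityMeasure P] [IsProbabilityMeasure prior]
    (hloss : Measurable (fun p : Θ × Z => loss p.1 p.2)) (hη : 0 < η) (hn : 1 ≤ n)
    (hh : Integrable h P) (hbd : ∀ f z, |loss f z - loss f₀ z| ≤ h z) :
    BayesICWellDefined P loss prior η f₀ n := by
  have key := bayesIC_eq (prior := prior) hloss hη hn hbd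
  refine ⟨Eventually.of_forall fun z => ⟨(key z).1, (key z).2.1, (key z).2.2.1⟩, ?_⟩
  rw [funext fun z => (key z).2.2.2]
  exact (integrable_log_evidenceRatio hloss hη hh hbd).neg.div_const _

/-- Upper bound on the expected information complexity in terms of the prior mass of a set on which
the excess loss is small. -/
lemma expectedBayesIC_le [IsProbabilityMeasure P] [IsProbabilityMeasure prior]
    (hloss : Measurable (fun p : Θ × Z => loss p.1 p.2)) (hη : 0 < η) (hn : 1 ≤ n)
    (hh : Integrable h P) (hbd : ∀ f z, |loss f z - loss f₀ z| ≤ h z)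
    {B : Set Θ} (hB : MeasurableSet B) {ε p : ℝ} (hp : 0 < p) (hpB : p ≤ prior.real B)
    (hεB : ∀ f ∈ B, ∀ z, |loss f z - loss f₀ z| ≤ ε * h z) :
    expectedBayesIC P loss prior η f₀ n ≤ ε * ∫ z, h z ∂P + -Real.log p / (η * n) := by
  have key := bayesIC_eq (prior := prior) hloss hη hn hbd
  have hn0 : (0 : ℝ) < n := by exact_mod_cast hn
  have hpt (z : Fin n → Z) : bayesIC loss prior η f₀ n z ≤
      ε / n * ∑ i, h (z i) + -Real.log p / (η * n) := by
    have hint := integrable_exp_excess (prior := prior) hloss hη hbd z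
    -- Discard the prior outside `B` and bound the integrand from below on `B`.
    have h1 : p * Real.exp (-η * (ε * ∑ i, h (z i))) ≤ evidenceRatio loss prior η f₀ z := by
      calc p * Real.exp (-η * (ε * ∑ i, h (z i)))
          ≤ prior.real B * Real.exp (-η * (ε * ∑ i, h (z i))) := by gcongr
        _ = ∫ f in B, Real.exp (-η * (ε * ∑ i, h (z i))) ∂prior := by simp
        _ ≤ ∫ f in B, Real.exp (-η * ∑ i, (loss f (z i) - loss f₀ (z i))) ∂prior := by
          refine setIntegral_mono_on (integrable_const _) hint.integrableOn hB fun f hf => ?_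
          rw [Real.exp_le_exp]
          have : ∑ i, (loss f (z i) - loss f₀ (z i)) ≤ ε * ∑ i, h (z i) := by
            rw [Finset.mul_sum]
            exact Finset.sum_le_sum fun i _ => le_of_abs_le (hεB f hf (z i))
          nlinarith
        _ ≤ _ := setIntegral_le_integral hint (Eventually.of_forall fun f => (Real.exp_pos _).le)
    have h2 := Real.log_le_log (by positivity) h1
    rw [Real.log_mul hp.ne' (Real.exp_pos _).ne', Real.log_exp] at h2
    rw [(key z).2.2.2]
    have h3 : ε / n * ∑ i, h (z i) + -Real.log p / (η * n) =
        (η * (ε * ∑ i, h (z i)) - Real.log p) / (η * n) := by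
      field_simp
      ring
    rw [h3]
    gcongr
    linarith
  have hI : Integrable (fun z : Fin n → Z => ε / n * ∑ i, h (z i) + -Real.log p / (η * n))
      (Measure.pi fun _ => P) :=
    ((integrable_sum_eval hh).const_mul _).add (integrable_const _)
  refine (integral_mono (bayesICWellDefined_of_bound hloss hη hn hh hbd).2 hI hpt).trans_eq ?_
  rw [integral_add ((integrable_sum_eval hh).const_mul _) (integrable_const _),
    integral_const_mul, integral_sum_eval hh, integral_const]
  simp only [probReal_univ, one_smul]
  field_simp

/-- Under the central condition with comparator `f₀`, the expected information complexity relative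
to `f₀` is nonnegative. -/
lemma expectedBayesIC_nonneg [IsProbabilityMeasure P] [IsProbabilityMeasure prior]
    (hloss : Measurable (fun p : Θ × Z => loss p.1 p.2)) (hη : 0 < η) (hn : 1 ≤ n)
    (hh : Integrable h P) (hbd : ∀ f z, |loss f z - loss f₀ z| ≤ h z)
    {ηbar : ℝ} (hle : η ≤ ηbar)
    (hc : ∀ᵐ f ∂prior,
      ∫⁻ z, ENNReal.ofReal (Real.exp (-ηbar * (loss f z - loss f₀ z))) ∂P ≤ 1) :
    0 ≤ expectedBayesIC P loss prior η f₀ n := by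
  have key := bayesIC_eq (prior := prior) hloss hη hn hbd
  have hn0 : (0 : ℝ) < n := by exact_mod_cast hn
  have hηbar : 0 < ηbar := hη.trans_le hle
  have hlm (f : Θ) : Measurable (loss f) := hloss.comp measurable_prodMk_left
  have hone : ∀ᵐ f ∂prior, Integrable (fun z => Real.exp (-η * (loss f z - loss f₀ z))) P ∧
      ∫ z, Real.exp (-η * (loss f z - loss f₀ z)) ∂P ≤ 1 := by
    filter_upwards [hc] with f hf
    have hm (c : ℝ) : Measurable fun z => Real.exp (-c * (loss f z - loss f₀ z)) :=
      Real.measurable_exp.comp (((hlm f).sub (hlm f₀)).const_mul _)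
    have hib : Integrable (fun z => Real.exp (-ηbar * (loss f z - loss f₀ z))) P :=
      ⟨(hm ηbar).aestronglyMeasurable, (hasFiniteIntegral_iff_ofReal
        (Eventually.of_forall fun z => (Real.exp_pos _).le)).mpr (hf.trans_lt ENNReal.one_lt_top)⟩
    have hib1 : ∫ z, Real.exp (-ηbar * (loss f z - loss f₀ z)) ∂P ≤ 1 := by
      rw [← ENNReal.ofReal_le_one, ofReal_integral_eq_lintegral_ofReal hib
        (Eventually.of_forall fun z => (Real.exp_pos _).le)]
      exact hf
    -- Passing from rate `ηbar` to `η`: convexity of `exp` between `-ηbar * x` and `0`, with weight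
    -- `w` on the former.
    set w := η / ηbar
    have hw0 : 0 ≤ w := by positivity
    have hw1 : w ≤ 1 := (div_le_one hηbar).mpr hle
    have hpt (z : Z) : Real.exp (-η * (loss f z - loss f₀ z)) ≤
        w * Real.exp (-ηbar * (loss f z - loss f₀ z)) + (1 - w) := by
      have := convexOn_exp.2 (Set.mem_univ (-ηbar * (loss f z - loss f₀ z)))
        (Set.mem_univ 0) hw0 (sub_nonneg.mpr hw1) (by ring)
      simp only [smul_eq_mul, mul_zero, add_zero, Real.exp_zero, mul_one] at this
      refine le_trans (le_of_eq ?_) this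
      congr 1
      simp only [w]
      field_simp
    have hI2 : Integrable (fun z => w * Real.exp (-ηbar * (loss f z - loss f₀ z)) + (1 - w)) P :=
      (hib.const_mul w).add (integrable_const _)
    have hI1 : Integrable (fun z => Real.exp (-η * (loss f z - loss f₀ z))) P :=
      hI2.mono' (hm η).aestronglyMeasurable (Eventually.of_forall fun z => by
        rw [Real.norm_eq_abs, Real.abs_exp]
        exact hpt z)
    refine ⟨hI1, (integral_mono hI1 hI2 hpt).trans ?_⟩
    rw [integral_add (hib.const_mul w) (integrable_const _), integral_const_mul, integral_const]
    simp only [probReal_univ, one_smul]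
    nlinarith
  -- `E W ≤ 1`: by Tonelli and independence, `E W` is the prior average of an `n`-th power of a
  -- number at most `1`.
  have hlint : ∫⁻ z : Fin n → Z, ENNReal.ofReal (evidenceRatio loss prior η f₀ z)
      ∂(Measure.pi fun _ => P) ≤ 1 := by
    have hinner (z : Fin n → Z) : ENNReal.ofReal (evidenceRatio loss prior η f₀ z) =
        ∫⁻ f, ENNReal.ofReal (Real.exp (-η * ∑ i, (loss f (z i) - loss f₀ (z i)))) ∂prior :=
      ofReal_integral_eq_lintegral_ofReal (integrable_exp_excess hloss hη hbd z)
        (Eventually.of_forall fun f => (Real.exp_pos _).le)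
    simp_rw [hinner]
    rw [lintegral_lintegral_swap (measurable_exp_excess hloss n).ennreal_ofReal.aemeasurable]
    refine (lintegral_mono_ae (g := fun _ => 1) ?_).trans (by simp)
    filter_upwards [hone] with f hf
    have hprod (z : Fin n → Z) : Real.exp (-η * ∑ i, (loss f (z i) - loss f₀ (z i))) =
        ∏ i, Real.exp (-η * (loss f (z i) - loss f₀ (z i))) := by
      rw [Finset.mul_sum, Real.exp_sum]
    simp_rw [hprod]
    rw [← ofReal_integral_eq_lintegral_ofReal (Integrable.fintype_prod fun _ => hf.1)
      (Eventually.of_forall fun z => Finset.prod_nonneg fun i _ => (Real.exp_pos _).le),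
      ENNReal.ofReal_le_one,
      integral_fintype_prod_eq_prod (fun _ : Fin n => fun z =>
        Real.exp (-η * (loss f z - loss f₀ z)))]
    exact Finset.prod_le_one (fun i _ => integral_nonneg fun z => (Real.exp_pos _).le)
      fun i _ => hf.2
  have hpos (z : Fin n → Z) := (abs_log_evidenceRatio_le (prior := prior) hloss hη hbd z).1
  have hWint : Integrable (fun z : Fin n → Z => evidenceRatio loss prior η f₀ z)
      (Measure.pi fun _ => P) :=
    ⟨(measurable_evidenceRatio hloss).aestronglyMeasurable, (hasFiniteIntegral_iff_ofReal
      (Eventually.of_forall fun z => (hpos z).le)).mpr (hlint.trans_lt ENNReal.one_lt_top)⟩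
  have hW1 : ∫ z : Fin n → Z, evidenceRatio loss prior η f₀ z ∂(Measure.pi fun _ => P) ≤ 1 := by
    rw [← ENNReal.ofReal_le_one, ofReal_integral_eq_lintegral_ofReal hWint
      (Eventually.of_forall fun z => (hpos z).le)]
    exact hlint
  -- Jensen in the form `log W ≤ W - 1`.
  have hlog : ∫ z : Fin n → Z, Real.log (evidenceRatio loss prior η f₀ z)
      ∂(Measure.pi fun _ => P) ≤ 0 := by
    have := integral_mono (integrable_log_evidenceRatio hloss hη hh hbd)
      (hWint.sub (integrable_const (1 : ℝ))) fun z => Real.log_le_sub_one_of_pos (hpos z)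
    refine this.trans ?_
    simp only [Pi.sub_apply]
    rw [integral_sub hWint (integrable_const _), integral_const]
    simp only [probReal_univ, one_smul]
    linarith
  rw [expectedBayesIC, integral_congr_ae (Eventually.of_forall fun z => (key z).2.2.2),
    integral_div, integral_neg]
  have : 0 < η * n := by positivity
  exact div_nonneg (by linarith) this.le

/-- The expected information complexities relative to two comparators differ by their expected
excess loss. -/
lemma expectedBayesIC_sub [IsProbabilityMeasure P] [IsProbabilityMeasure prior]
    (hloss : Measurable (fun p : Θ × Z => loss p.1 p.2)) (hη : 0 < η) (hn : 1 ≤ n)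
    {h₁ : Z → ℝ} (hh : Integrable h P) (hh₁ : Integrable h₁ P) {f₁ : Θ}
    (hbd : ∀ f z, |loss f z - loss f₀ z| ≤ h z) (hbd₁ : ∀ f z, |loss f z - loss f₁ z| ≤ h₁ z) :
    expectedBayesIC P loss prior η f₀ n =
      expectedBayesIC P loss prior η f₁ n + ∫ z, (loss f₁ z - loss f₀ z) ∂P := by
  have hn0 : (0 : ℝ) < n := by exact_mod_cast hn
  have hlm (f : Θ) : Measurable (loss f) := hloss.comp measurable_prodMk_left
  have hd : Integrable (fun z => loss f₁ z - loss f₀ z) P :=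
    hh.mono' ((hlm f₁).sub (hlm f₀)).aestronglyMeasurable (Eventually.of_forall (hbd f₁))
  have hpt (z : Fin n → Z) : bayesIC loss prior η f₀ n z =
      bayesIC loss prior η f₁ n z + (1 / (n : ℝ)) * ∑ i, (loss f₁ (z i) - loss f₀ (z i)) := by
    rw [(bayesIC_eq hloss hη hn hbd z).2.2.2, (bayesIC_eq hloss hη hn hbd₁ z).2.2.2]
    -- Changing the comparator multiplies `W` by a factor that does not depend on `f`.
    have : evidenceRatio loss prior η f₀ z =
        Real.exp (-η * ∑ i, (loss f₁ (z i) - loss f₀ (z i))) * evidenceRatio loss prior η f₁ z := by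
      rw [evidenceRatio, evidenceRatio, ← integral_const_mul]
      refine integral_congr_ae (Eventually.of_forall fun f => ?_)
      simp only [← Real.exp_add, ← mul_add, ← Finset.sum_add_distrib]
      congr 2
      exact Finset.sum_congr rfl fun i _ => by ring
    rw [this, Real.log_mul (Real.exp_pos _).ne' (abs_log_evidenceRatio_le hloss hη hbd₁ z).1.ne',
      Real.log_exp]
    field_simp
    ring
  rw [expectedBayesIC, integral_congr_ae (Eventually.of_forall hpt), integral_add
    (bayesICWellDefined_of_bound hloss hη hn hh₁ hbd₁).2 ((integrable_sum_eval hd).const_mul _),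
    integral_const_mul, integral_sum_eval hd, ← expectedBayesIC]
  field_simp

/-! ### Changing the loss off the support of the prior -/

variable {loss' : Θ → Z → ℝ}

lemma genBayes_congr (hl : ∀ᵐ f ∂prior, loss f = loss' f) (z : Fin n → Z) :
    genBayes loss prior η z = genBayes loss' prior η z :=
  tilted_congr (hl.mono fun f hf => by simp only [hf])

/-- Agreement at `f₀` is a separate hypothesis because a single label may be null for the prior. -/
lemma empiricalExcess_ae_eq (hl : ∀ᵐ f ∂prior, loss f = loss' f) (h₀ : loss f₀ = loss' f₀)
    (z : Fin n → Z) :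
    empiricalExcess loss f₀ z =ᵐ[genBayes loss' prior η z] empiricalExcess loss' f₀ z :=
  (tilted_absolutelyContinuous _ _).ae_le (hl.mono fun f hf => by
    simp only [empiricalExcess, hf, h₀])

lemma bayesIC_congr (hl : ∀ᵐ f ∂prior, loss f = loss' f) (h₀ : loss f₀ = loss' f₀) (n : ℕ) :
    bayesIC loss prior η f₀ n = bayesIC loss' prior η f₀ n := by
  ext z
  rw [bayesIC, bayesIC, infoComplexity, infoComplexity, genBayes_congr hl,
    integral_congr_ae (empiricalExcess_ae_eq hl h₀ z)]

lemma expectedBayesIC_congr (hl : ∀ᵐ f ∂prior, loss f = loss' f) (h₀ : loss f₀ = loss' f₀)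
    (n : ℕ) : expectedBayesIC P loss prior η f₀ n = expectedBayesIC P loss' prior η f₀ n := by
  rw [expectedBayesIC, expectedBayesIC, bayesIC_congr hl h₀]

lemma bayesICWellDefined_congr (hl : ∀ᵐ f ∂prior, loss f = loss' f) (h₀ : loss f₀ = loss' f₀)
    (h : BayesICWellDefined P loss' prior η f₀ n) : BayesICWellDefined P loss prior η f₀ n := by
  refine ⟨h.1.mono fun z hz => ?_, ?_⟩
  · rw [genBayes_congr hl]
    exact ⟨hz.1.congr (hl.mono fun f hf => by simp only [hf]),
      hz.2.1.congr (empiricalExcess_ae_eq hl h₀ z).symm, hz.2.2⟩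
  · rw [bayesIC_congr hl h₀]
    exact h.2

end GeneralizedBayes

/-! ### Countable disjoint unions of measurable spaces -/

section Sigma

variable {ι : Type*} {α : ι → Type*} [∀ i, MeasurableSpace (α i)]

lemma measurableSet_sigma_iff {s : Set (Σ i, α i)} :
    MeasurableSet s ↔ ∀ i, MeasurableSet (Sigma.mk i ⁻¹' s) := by
  rw [MeasurableSpace.measurableSet_iInf]
  rfl

lemma measurableEmbedding_sigmaMk (i : ι) : MeasurableEmbedding (Sigma.mk i : α i → Σ i, α i) := by
  refine ⟨sigma_mk_injective, fun s hs => measurableSet_sigma_iff.mp hs i, fun s hs => ?_⟩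
  rw [measurableSet_sigma_iff]
  intro j
  by_cases h : i = j
  · subst h
    rwa [Set.preimage_image_eq _ sigma_mk_injective]
  · rw [Set.preimage_image_sigmaMk_of_ne (Ne.symm h)]
    exact MeasurableSet.empty

/-- A preimage is a countable union of images under the measurable embeddings of the pieces `α i ×
β`. -/
lemma measurable_sigma_prod [Countable ι] {β γ : Type*} [MeasurableSpace β] [MeasurableSpace γ]
    {f : (Σ i, α i) × β → γ} (hf : ∀ i, Measurable fun p : α i × β => f (⟨i, p.1⟩, p.2)) :
    Measurable f := by
  intro s hs
  have : f ⁻¹' s = ⋃ i, Prod.map (Sigma.mk i) id ''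
      ((fun p : α i × β => f (⟨i, p.1⟩, p.2)) ⁻¹' s) := by
    ext ⟨⟨i, a⟩, b⟩
    simp only [Set.mem_iUnion, Set.mem_image, Set.mem_preimage, Prod.exists, Prod.map_apply, id]
    constructor
    · exact fun h => ⟨i, a, b, h, rfl⟩
    · rintro ⟨j, a', b', h, he⟩
      rw [Prod.mk.injEq] at he
      rw [← he.1, ← he.2]
      exact h
  rw [this]
  exact MeasurableSet.iUnion fun i =>
    ((measurableEmbedding_sigmaMk i).prodMap .id).measurableSet_image.mpr (hf i hs)

end Sigma

/-! ### Moment generating functions under a uniform exponential moment bound -/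

/-- Second-order Taylor bound for `|u| ≤ 1`; beyond that, `u ^ 2 ≥ 1` lets the last term dominate.
-/
lemma exp_le_one_add_add_sq_mul_exp_abs (u : ℝ) :
    Real.exp u ≤ 1 + u + u ^ 2 * Real.exp |u| := by
  have h1 : 1 ≤ Real.exp |u| := Real.one_le_exp (abs_nonneg u)
  rcases le_or_gt |u| 1 with h | h
  · have := le_of_abs_le (Real.abs_exp_sub_one_sub_id_le h)
    nlinarith [sq_nonneg u]
  · have hsq : 1 ≤ u ^ 2 := by rw [← sq_abs]; nlinarith
    rcases lt_or_ge u 0 with hu | hu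
    · have : Real.exp u ≤ 1 := Real.exp_le_one_iff.mpr hu.le
      rw [abs_of_neg hu] at h
      nlinarith
    · rw [abs_of_nonneg hu] at *
      nlinarith

lemma integrable_abs_of_exp {Ω : Type*} [MeasurableSpace Ω] {μ : Measure Ω} {X : Ω → ℝ}
    (hX : Measurable X) {s : ℝ} (hs : 0 < s)
    (h : ∫⁻ ω, ENNReal.ofReal (Real.exp (s * |X ω|)) ∂μ < ∞) :
    Integrable (fun ω => Real.exp (s * |X ω|)) μ ∧ Integrable X μ := by
  have h1 : Integrable (fun ω => Real.exp (s * |X ω|)) μ :=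
    ⟨by fun_prop, (hasFiniteIntegral_iff_ofReal
      (Eventually.of_forall fun ω => (Real.exp_pos _).le)).mpr h⟩
  refine ⟨h1, (h1.const_mul s⁻¹).mono' hX.aestronglyMeasurable (Eventually.of_forall fun ω => ?_)⟩
  rw [Real.norm_eq_abs, ← div_eq_inv_mul, le_div_iff₀' hs]
  linarith [Real.add_one_le_exp (s * |X ω|)]

/-- Quadratic bound for centered moment generating functions, uniform over all laws with a common
exponential moment bound. -/
lemma exists_mgf_le_one_add_sq {s : ℝ} (hs : 0 < s) {C : ℝ≥0∞} (hC : C < ∞) (R : ℝ) :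
    ∃ c t₀ : ℝ, 0 < c ∧ 0 < t₀ ∧ ∀ μ : Measure ℝ, IsProbabilityMeasure μ →
      ∫⁻ y, ENNReal.ofReal (Real.exp (s * |y|)) ∂μ ≤ C → ∀ m : ℝ, |m| ≤ R → ∫ y, y ∂μ = m →
      ∀ t : ℝ, |t| ≤ t₀ →
        Integrable (fun y => Real.exp (t * (y - m))) μ ∧
        ∫ y, Real.exp (t * (y - m)) ∂μ ≤ 1 + c * t ^ 2 := by
  -- With `w = |y| + R`, the inequality `x² / 2 ≤ exp x` at `x = s w / 4` gives `w² ≤ (32 / s²) exp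
  -- (s w / 4)`. For `|t| ≤ s / 4` the factor `exp |t (y - m)|` costs another `exp (s w / 4)`; of
  -- the product `exp (s w / 2)`, the part from `R` goes into `K`.
  set K : ℝ := 32 / s ^ 2 * Real.exp (s / 2 * R) with hK
  have hKpos : 0 < K := by positivity
  -- The `+ 1` makes the constant positive even when `C = 0`.
  refine ⟨K * (C.toReal + 1), s / 4, by positivity, by positivity,
    fun μ hμ hexp m hm hmean t ht => ?_⟩
  obtain ⟨hi, hy⟩ : Integrable (fun y => Real.exp (s * |y|)) μ ∧ Integrable (fun y => y) μ :=
    integrable_abs_of_exp measurable_id hs (hexp.trans_lt hC)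
  have hle : ∫ y, Real.exp (s * |y|) ∂μ ≤ C.toReal := by
    rw [integral_eq_lintegral_of_nonneg_ae (Eventually.of_forall fun y => (Real.exp_pos _).le)
      (by fun_prop)]
    exact ENNReal.toReal_mono hC.ne hexp
  have hpt (y : ℝ) : Real.exp (t * (y - m)) ≤
      1 + t * (y - m) + K * t ^ 2 * Real.exp (s * |y|) := by
    refine (exp_le_one_add_add_sq_mul_exp_abs _).trans ?_
    gcongr 1 + t * (y - m) + ?_
    set w := |y| + R with hw
    have hym : |y - m| ≤ w := (abs_sub _ _).trans (by linarith)
    have hw0 : 0 ≤ w := (abs_nonneg _).trans hym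
    have hq := Real.quadratic_le_exp_of_nonneg (x := s / 4 * w) (by positivity)
    have h1 : w ^ 2 ≤ 32 / s ^ 2 * Real.exp (s / 4 * w) := by
      rw [div_mul_eq_mul_div, le_div_iff₀ (by positivity)]
      nlinarith [mul_nonneg hs.le hw0]
    have h2 : |t * (y - m)| ≤ s / 4 * w := by
      rw [abs_mul]
      gcongr
    calc (t * (y - m)) ^ 2 * Real.exp |t * (y - m)|
        = t ^ 2 * |y - m| ^ 2 * Real.exp |t * (y - m)| := by rw [mul_pow, sq_abs]
      _ ≤ t ^ 2 * (32 / s ^ 2 * Real.exp (s / 4 * w)) * Real.exp (s / 4 * w) := by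
        gcongr
        exact (pow_le_pow_left₀ (abs_nonneg _) hym 2).trans h1
      _ = t ^ 2 * (32 / s ^ 2) * Real.exp (s / 2 * R + s / 2 * |y|) := by
        rw [mul_assoc, mul_assoc, ← Real.exp_add, ← mul_assoc, hw]
        congr 2
        ring
      _ = K * t ^ 2 * Real.exp (s / 2 * |y|) := by
        rw [Real.exp_add, hK]
        ring
      _ ≤ K * t ^ 2 * Real.exp (s * |y|) := by
        gcongr
        linarith
  have hcen : Integrable (fun y => t * (y - m)) μ := (hy.sub (integrable_const _)).const_mul _
  have hlin : Integrable (fun y => 1 + t * (y - m)) μ := (integrable_const _).add hcen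
  have hI : Integrable (fun y => 1 + t * (y - m) + K * t ^ 2 * Real.exp (s * |y|)) μ :=
    hlin.add (hi.const_mul _)
  have hI' : Integrable (fun y => Real.exp (t * (y - m))) μ :=
    hI.mono' (by fun_prop) (Eventually.of_forall fun y => by
      rw [Real.norm_eq_abs, Real.abs_exp]
      exact hpt y)
  refine ⟨hI', (integral_mono hI' hI hpt).trans ?_⟩
  rw [integral_add hlin (hi.const_mul _), integral_add (integrable_const _) hcen,
    integral_const_mul, integral_const_mul,
    integral_sub hy (integrable_const _), hmean, integral_const, integral_const]
  simp only [probReal_univ, one_smul, sub_self, mul_zero, add_zero]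
  nlinarith [mul_nonneg hKpos.le (sq_nonneg t)]

/-! ### Asymptotics -/

lemma isSoftO_of_le {u : ℕ → ℝ} {A B : ℝ} (h0 : ∀ n : ℕ, 1 ≤ n → 0 ≤ u n)
    (h : ∀ n : ℕ, 1 ≤ n → u n ≤ 1 / n * (A + B * Real.log n)) :
    IsSoftO u (fun n => 1 / (n : ℝ)) := by
  refine ⟨1, Asymptotics.IsBigO.of_bound (|A| + |B|) ?_⟩
  -- From `n = 3` on, `log n ≥ 1`, so the constant `A` is absorbed into the logarithm.
  filter_upwards [eventually_ge_atTop 3] with n hn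
  have hlog : 1 ≤ Real.log n := by
    rw [Real.le_log_iff_exp_le (by positivity)]
    exact Real.exp_one_lt_three.le.trans (by exact_mod_cast hn)
  have hn0 : (0 : ℝ) < n := by positivity
  have hr : 0 ≤ 1 / (n : ℝ) * Real.log n := mul_nonneg (by positivity) (by linarith)
  rw [Real.norm_eq_abs, abs_of_nonneg (h0 n (by omega)), pow_one, Real.norm_eq_abs,
    abs_of_nonneg hr]
  refine (h n (by omega)).trans ?_
  rw [mul_left_comm]
  gcongr
  nlinarith [le_abs_self A, le_abs_self B, abs_nonneg A, abs_nonneg B]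

namespace GLMSequence

variable {D : ℕ∞} {𝒳 : Set (Coord D → ℝ)} {M : ℕ∞} (G : GLMSequence D 𝒳 M)

/-! ### Measurability -/

/-- By the Lusin-Souslin theorem, the injective continuous link sends Borel sets to Borel sets. Off
its range, `Function.invFunOn` is a constant default value. -/
lemma measurable_invLink : Measurable G.invLink := by
  have hm (s : Set ℝ) (hs : MeasurableSet s) : MeasurableSet (G.link '' (G.linkDomain ∩ s)) :=
    (G.isOpen_linkDomain.measurableSet.inter hs).image_of_continuousOn_injOn
      (G.continuousOn_link.mono Set.inter_subset_left) (G.injOn_link.mono Set.inter_subset_left)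
  have hoff : ∃ c, ∀ t ∉ G.link '' G.linkDomain, G.invLink t = c :=
    ⟨_, fun t ht => Function.invFunOn_neg ht⟩
  obtain ⟨c, hc⟩ := hoff
  have hon (x) (hx : x ∈ G.linkDomain) : G.invLink (G.link x) = x :=
    G.injOn_link.leftInvOn_invFunOn hx
  intro s hs
  have heq : G.invLink ⁻¹' s = G.link '' (G.linkDomain ∩ s) ∪
      ((G.link '' (G.linkDomain ∩ Set.univ))ᶜ ∩ {_t | c ∈ s}) := by
    ext t
    by_cases ht : t ∈ G.link '' G.linkDomain
    · obtain ⟨x, hx, rfl⟩ := ht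
      simp only [Set.mem_preimage, hon x hx, Set.inter_univ, Set.mem_union, Set.mem_inter_iff,
        Set.mem_compl_iff, Set.mem_image_of_mem _ hx, not_true_eq_false, false_and, or_false]
      constructor
      · exact fun h => ⟨x, ⟨hx, h⟩, rfl⟩
      · rintro ⟨x', ⟨hx', h⟩, he⟩
        rwa [← G.injOn_link hx' hx he]
    · have : t ∉ G.link '' (G.linkDomain ∩ s) :=
        fun h => ht (Set.image_mono Set.inter_subset_left h)
      simp [hc t ht, ht, this]
  rw [heq]
  exact (hm s hs).union ((hm _ .univ).compl.inter (.const _))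

lemma measurable_condMean (j : ModelIndex M) :
    Measurable fun p : (Fin (G.dim j) → ℝ) × 𝒳 => G.condMean j p.1 p.2 := by
  refine G.measurable_invLink.comp (Finset.measurable_fun_sum _ fun i _ => ?_)
  refine Measurable.mul (by fun_prop) ?_
  exact (measurable_pi_apply _).comp (measurable_subtype_coe.comp measurable_snd)

lemma measurableSet_predictors : MeasurableSet G.predictors :=
  measurableSet_sigma_iff.mpr fun j => G.measurableSet_param j

/-! ### The loss with clamped conditional means -/

/-- The natural parameter of `f` at `x`, with conditional mean clamped to `[a, b]`. -/
noncomputable def clampedParam (a b : ℝ) (f : G.Label) (x : 𝒳) : ℝ :=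
  G.family.clampedInvMean a b (G.condMean f.1 f.2 x)

/-- The log loss with conditional mean clamped to `[a, b]`. -/
noncomputable def clampedLoss (a b : ℝ) (f : G.Label) (z : 𝒳 × ℝ) : ℝ :=
  G.family.logNormalizer (G.clampedParam a b f z.1) - G.clampedParam a b f z.1 * z.2
    - G.family.r z.2

variable {G} {a b : ℝ}

/-- On predictors the clamp is inactive. Elsewhere it keeps the natural parameter in a compact set,
so bounds and measurability hold on the whole label space. -/
lemma loss_eq_clampedLoss
    (hm : ∀ j, ∀ β ∈ G.param j, ∀ x : 𝒳, G.condMean j β x ∈ Set.Icc a b)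
    {f : G.Label} (hf : f ∈ G.predictors) : G.loss f = G.clampedLoss a b f := by
  ext z
  rw [loss, condDensity, ExpFamily.density, Real.log_exp, clampedLoss, clampedParam,
    ExpFamily.clampedInvMean_of_mem _ (hm f.1 f.2 hf z.1), natParam]
  ring

lemma clampedLoss_sub (f f₀ : G.Label) (z : 𝒳 × ℝ) :
    G.clampedLoss a b f z - G.clampedLoss a b f₀ z =
      G.family.logNormalizer (G.clampedParam a b f z.1)
        - G.family.logNormalizer (G.clampedParam a b f₀ z.1)
        - (G.clampedParam a b f z.1 - G.clampedParam a b f₀ z.1) * z.2 := by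
  rw [clampedLoss, clampedLoss]
  ring

/-- Although `invMean` is a choice function, after clamping it and its log-normalizer are Lipschitz
in the mean, hence measurable. -/
lemma measurable_clampedLoss {κ L : ℝ} (hQ : G.family.ClampedBounds a b κ L) :
    Measurable fun p : G.Label × (𝒳 × ℝ) => G.clampedLoss a b p.1 p.2 := by
  have hT : Measurable (G.family.clampedInvMean a b) :=
    (LipschitzWith.of_dist_le_mul (K := ⟨L, hQ.L_pos.le⟩) hQ.abs_sub_le).continuous.measurable
  have hF : Measurable fun m => G.family.logNormalizer (G.family.clampedInvMean a b m) :=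
    (LipschitzWith.of_dist_le_mul (K := ⟨L * L, mul_self_nonneg L⟩) fun m m' =>
      (hQ.abs_logNormalizer_sub_le m m').trans (by
        change _ ≤ L * L * |m - m'|
        rw [mul_assoc]
        exact mul_le_mul_of_nonneg_left (hQ.abs_sub_le m m') hQ.L_pos.le)).continuous.measurable
  refine measurable_sigma_prod fun j => ?_
  have hc : Measurable fun p : (Fin (G.dim j) → ℝ) × (𝒳 × ℝ) => G.condMean j p.1 p.2.1 :=
    (G.measurable_condMean j).comp (by fun_prop :
      Measurable fun p : (Fin (G.dim j) → ℝ) × (𝒳 × ℝ) => (p.1, p.2.1))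
  exact ((hF.comp hc).sub ((hT.comp hc).mul (by fun_prop))).sub
    (G.family.measurable_r.comp (by fun_prop))

/-- Keeping the parameter difference as a factor serves two purposes: bounded by `L` it yields a
global envelope, and on a small ball it makes the excess loss small. -/
lemma abs_clampedLoss_sub_le {κ L : ℝ} (hQ : G.family.ClampedBounds a b κ L)
    (f f₀ : G.Label) (z : 𝒳 × ℝ) :
    |G.clampedLoss a b f z - G.clampedLoss a b f₀ z| ≤
      |G.clampedParam a b f z.1 - G.clampedParam a b f₀ z.1| * (L + |z.2|) := by
  rw [clampedLoss_sub]
  refine (abs_sub _ _).trans ?_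
  rw [abs_mul, mul_add, mul_comm _ L]
  exact add_le_add_left (hQ.abs_logNormalizer_sub_le _ _) _

/-! ### The hierarchical prior -/

variable (π : G.HierPrior)

instance : IsProbabilityMeasure π.measure := by
  refine ⟨?_⟩
  have hw (j) : π.within j Set.univ = 1 := by
    rw [HierPrior.within, withDensity_apply _ .univ, Measure.restrict_univ, π.lintegral_dens]
  rw [HierPrior.measure, Measure.sum_apply _ .univ]
  simp only [Measure.smul_apply, smul_eq_mul]
  rw [← π.weight.tsum_coe]
  refine tsum_congr fun j => ?_
  rw [Measure.map_apply (measurableEmbedding_sigmaMk j).measurable .univ, Set.preimage_univ, hw,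
    mul_one]

lemma ae_mem_predictors : ∀ᵐ f ∂π.measure, f ∈ G.predictors := by
  rw [HierPrior.measure, Measure.ae_sum_iff]
  intro j
  refine Measure.ae_smul_measure ?_ _
  refine (ae_map_iff (p := fun f => f ∈ G.predictors)
    (measurableEmbedding_sigmaMk j).measurable.aemeasurable G.measurableSet_predictors).mpr ?_
  exact (withDensity_absolutelyContinuous _ _).ae_le (ae_restrict_mem (G.measurableSet_param j))

/-- The hierarchical prior puts mass of polynomial order on small balls within a model. -/
lemma exists_prior_ball_ge (j : ModelIndex M) {β₀ : Fin (G.dim j) → ℝ} (hβ₀ : β₀ ∈ G.param j) :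
    ∃ R p : ℝ, 0 < R ∧ 0 < p ∧ ∀ t : ℝ, 0 < t → t ≤ 1 →
      p * t ^ G.dim j ≤
        π.measure.real (Sigma.mk j '' (G.param j ∩ Metric.closedBall β₀ (R * t))) := by
  -- A probability density lives on the parameter set, so the set is not Lebesgue null.
  have hvol : volume (G.param j) ≠ 0 := by
    intro h0
    have := π.lintegral_dens j
    rw [Measure.restrict_eq_zero.mpr h0, lintegral_zero_measure] at this
    exact zero_ne_one this
  obtain ⟨k, hk⟩ : ∃ k : ℕ, volume (G.param j ∩ Metric.closedBall β₀ (k + 1)) ≠ 0 := by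
    by_contra! hall
    apply hvol
    rw [← Set.inter_univ (G.param j), ← nonpos_iff_eq_zero,
      show (Set.univ : Set (Fin (G.dim j) → ℝ)) = ⋃ k : ℕ, Metric.closedBall β₀ (k + 1) from ?_,
      Set.inter_iUnion]
    · exact (measure_iUnion_null hall).le
    · refine (Set.eq_univ_of_forall fun x => Set.mem_iUnion.mpr ?_).symm
      obtain ⟨k, hk⟩ := exists_nat_ge (dist x β₀)
      exact ⟨k, by rw [Metric.mem_closedBall]; linarith⟩
  set R : ℝ := k + 1 with hR
  have hRpos : 0 < R := by positivity
  obtain ⟨c, hc, hdens⟩ := π.bddAway j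
  have hfin : volume (G.param j ∩ Metric.closedBall β₀ R) ≠ ∞ :=
    ((measure_mono Set.inter_subset_right).trans_lt
      (isCompact_closedBall _ _).measure_lt_top).ne
  have hwfin : π.weight j ≠ ∞ := π.weight.apply_ne_top j
  refine ⟨R, (π.weight j).toReal * c * (volume (G.param j ∩ Metric.closedBall β₀ R)).toReal,
    hRpos, ?_, fun t ht ht1 => ?_⟩
  · have h1 := ENNReal.toReal_pos (π.weight_ne_zero j) hwfin
    have h2 := ENNReal.toReal_pos hk hfin
    positivity
  set S := G.param j ∩ Metric.closedBall β₀ (R * t) with hS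
  have hSm : MeasurableSet S := (G.measurableSet_param j).inter measurableSet_closedBall
  -- Contracting towards `β₀` by `t` stays in the convex parameter set and scales volume by `t ^
  -- dim`. Thus `β₀` may lie on the boundary.
  have hsub : AffineMap.homothety β₀ t '' (G.param j ∩ Metric.closedBall β₀ R) ⊆ S := by
    rintro _ ⟨x, ⟨hx, hxR⟩, rfl⟩
    refine ⟨?_, ?_⟩
    · rw [AffineMap.homothety_eq_lineMap]
      exact (G.convex_param j).lineMap_mem hβ₀ hx ⟨ht.le, ht1⟩
    · rw [Metric.mem_closedBall, dist_homothety_center, Real.norm_eq_abs, abs_of_pos ht,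
        mul_comm, dist_comm]
      exact mul_le_mul_of_nonneg_right hxR ht.le
  have hvolS : ENNReal.ofReal (t ^ G.dim j) * volume (G.param j ∩ Metric.closedBall β₀ R) ≤
      volume S := by
    refine le_trans (le_of_eq ?_) (measure_mono hsub)
    rw [Measure.addHaar_image_homothety, Module.finrank_fin_fun, abs_of_pos (by positivity)]
  have hwithin : ENNReal.ofReal c * volume S ≤ π.within j S := by
    rw [HierPrior.within, withDensity_apply _ hSm, Measure.restrict_restrict hSm,
      Set.inter_eq_left.mpr Set.inter_subset_left, ← setLIntegral_const]
    exact setLIntegral_mono' hSm fun β hβ => ENNReal.ofReal_le_ofReal (hdens β hβ.1)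
  have hmeas : π.weight j * π.within j S ≤ π.measure (Sigma.mk j '' S) := by
    rw [HierPrior.measure]
    refine le_trans (le_of_eq ?_) (Measure.le_sum_apply _ _ |>.trans' (ENNReal.le_tsum j))
    rw [Measure.smul_apply, smul_eq_mul, (measurableEmbedding_sigmaMk j).map_apply,
      Set.preimage_image_eq _ sigma_mk_injective]
  rw [measureReal_def, ← ENNReal.ofReal_le_iff_le_toReal (measure_ne_top _ _)]
  refine le_trans ?_ hmeas
  calc _ = π.weight j * (ENNReal.ofReal c *
        (ENNReal.ofReal (t ^ G.dim j) * volume (G.param j ∩ Metric.closedBall β₀ R))) := by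
        rw [ENNReal.ofReal_mul (by positivity), ENNReal.ofReal_mul (by positivity),
          ENNReal.ofReal_mul (by positivity), ENNReal.ofReal_toReal hwfin,
          ENNReal.ofReal_toReal hfin]
        ring
    _ ≤ π.weight j * π.within j S := by
        gcongr
        exact (mul_le_mul_right hvolS _).trans hwithin

end GLMSequence

/-! ### Generalized linear models: optimality, central condition and the rate -/

namespace GLMSequence

variable {D : ℕ∞} {𝒳 : Set (Coord D → ℝ)} {M : ℕ∞} {G : GLMSequence D 𝒳 M} {a b κ L : ℝ}
  {P : Measure (𝒳 × ℝ)} [IsProbabilityMeasure P]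

lemma integrable_snd_of_condition2 (h2 : Condition2 P) :
    Integrable (fun z : 𝒳 × ℝ => z.2) P := by
  obtain ⟨s, hs, C, hC, hexp⟩ := h2
  refine (integrable_abs_of_exp measurable_snd hs ?_).2
  rw [← Measure.lintegral_condKernel (by fun_prop)]
  refine (lintegral_mono_ae hexp).trans_lt ?_
  rw [lintegral_const, measure_univ, mul_one]
  exact hC

lemma integrable_envelope (h2 : Condition2 P) (c : ℝ) :
    Integrable (fun z : 𝒳 × ℝ => c * (L + |z.2|)) P :=
  ((integrable_const _).add (integrable_snd_of_condition2 h2).abs).const_mul c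

lemma abs_clampedLoss_sub_le_envelope (hQ : G.family.ClampedBounds a b κ L) (f f₀ : G.Label)
    (z : 𝒳 × ℝ) : |G.clampedLoss a b f z - G.clampedLoss a b f₀ z| ≤ L * (L + |z.2|) := by
  have := hQ.L_pos
  refine (abs_clampedLoss_sub_le hQ f f₀ z).trans ?_
  gcongr
  exact hQ.abs_sub_le_const _ _

lemma integrable_clampedLoss_sub (hQ : G.family.ClampedBounds a b κ L) (h2 : Condition2 P)
    (f f₀ : G.Label) :
    Integrable (fun z => G.clampedLoss a b f z - G.clampedLoss a b f₀ z) P := by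
  have hm := measurable_clampedLoss hQ
  exact (integrable_envelope h2 L).mono'
    ((hm.comp measurable_prodMk_left).sub (hm.comp measurable_prodMk_left)).aestronglyMeasurable
    (Eventually.of_forall (abs_clampedLoss_sub_le_envelope hQ f f₀))

/-- A well-specified predictor minimizes the risk. -/
lemma integral_clampedLoss_sub_nonneg (hQ : G.family.ClampedBounds a b κ L) (h2 : Condition2 P)
    {f₀ : G.Label} (hf₀ : ∀ x, G.condMean f₀.1 f₀.2 x ∈ Set.Icc a b)
    (hwell : ∀ᵐ x ∂P.fst, ∫ y, y ∂(P.condKernel x) = G.condMean f₀.1 f₀.2 x) (f : G.Label) :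
    0 ≤ ∫ z, (G.clampedLoss a b f z - G.clampedLoss a b f₀ z) ∂P := by
  rw [← Measure.integral_condKernel (integrable_clampedLoss_sub hQ h2 f f₀)]
  obtain ⟨s, hs, C, hC, hexp⟩ := h2
  refine integral_nonneg_of_ae ?_
  filter_upwards [hwell, hexp] with x hx hex
  have hy : Integrable (fun y => y) (P.condKernel x) :=
    (integrable_abs_of_exp measurable_id hs (hex.trans_lt hC)).2
  simp only [clampedLoss_sub, Pi.zero_apply]
  rw [integral_sub (integrable_const _) (hy.const_mul _), integral_const_mul, hx, integral_const]
  simp only [probReal_univ, one_smul]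
  -- The conditional expectation of the excess loss is now a Bregman divergence of `F`, hence
  -- nonnegative.
  have h1 := hQ.mul_sq_le _ (hf₀ x) (G.condMean f.1 f.2 x)
  have h2 := mul_nonneg hQ.κ_pos.le (sq_nonneg (G.clampedParam a b f x - G.clampedParam a b f₀ x))
  simp only [clampedParam] at *
  linarith

/-- The central condition, with a well-specified predictor as the comparator. -/
lemma exists_central_clampedLoss (hQ : G.family.ClampedBounds a b κ L) (h2 : Condition2 P)
    {f₀ : G.Label} (hf₀ : ∀ x, G.condMean f₀.1 f₀.2 x ∈ Set.Icc a b)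
    (hwell : ∀ᵐ x ∂P.fst, ∫ y, y ∂(P.condKernel x) = G.condMean f₀.1 f₀.2 x) :
    ∃ ηbar : ℝ, 0 < ηbar ∧ ∀ f, ∫⁻ z, ENNReal.ofReal (Real.exp
      (-ηbar * (G.clampedLoss a b f z - G.clampedLoss a b f₀ z))) ∂P ≤ 1 := by
  obtain ⟨s, hs, C, hC, hexp⟩ := h2
  obtain ⟨c, t₀, hc, ht₀, hmgf⟩ := exists_mgf_le_one_add_sq hs hC (max |a| |b|)
  have hκ := hQ.κ_pos
  have hL := hQ.L_pos
  -- The bound `κ / c` lets the divergence absorb the quadratic term of the noise; `t₀ / L` keeps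
  -- `ηbar * δ` in the range of the moment bound.
  refine ⟨min (κ / c) (t₀ / L), by positivity, fun f => ?_⟩
  set ηbar := min (κ / c) (t₀ / L) with hηbar
  have hpos : 0 < ηbar := by positivity
  have hηκ : c * ηbar ≤ κ := (le_div_iff₀' hc).mp (min_le_left _ _)
  have hηt : ηbar * L ≤ t₀ := (le_div_iff₀ hL).mp (min_le_right _ _)
  have hm := measurable_clampedLoss hQ
  have hmeas : Measurable fun z => ENNReal.ofReal (Real.exp
      (-ηbar * (G.clampedLoss a b f z - G.clampedLoss a b f₀ z))) :=
    (Real.measurable_exp.comp (((hm.comp measurable_prodMk_left).sub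
      (hm.comp measurable_prodMk_left)).const_mul _)).ennreal_ofReal
  rw [← Measure.lintegral_condKernel hmeas]
  refine (lintegral_mono_ae (g := fun _ => 1) ?_).trans (by simp)
  filter_upwards [hwell, hexp] with x hx hex
  set m := G.condMean f₀.1 f₀.2 x with hmdef
  set δ := G.clampedParam a b f x - G.clampedParam a b f₀ x with hδ
  set E := G.family.logNormalizer (G.clampedParam a b f x)
    - G.family.logNormalizer (G.clampedParam a b f₀ x) - m * δ with hE
  have hδL : |δ| ≤ L := hQ.abs_sub_le_const _ _
  have hEδ : κ * δ ^ 2 ≤ E := hQ.mul_sq_le _ (hf₀ x) _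
  have ht : |ηbar * δ| ≤ t₀ := by
    rw [abs_mul, abs_of_pos hpos]
    exact (mul_le_mul_of_nonneg_left hδL hpos.le).trans hηt
  obtain ⟨hint, hle⟩ := hmgf (P.condKernel x) inferInstance hex m
    (abs_le_max_abs_abs (hf₀ x).1 (hf₀ x).2) hx (ηbar * δ) ht
  -- Given `x`, the excess loss is the divergence `E` minus the centered noise `δ (y - m)`.
  have hpt (y : ℝ) : Real.exp (-ηbar * (G.clampedLoss a b f (x, y) - G.clampedLoss a b f₀ (x, y))) =
      Real.exp (-ηbar * E) * Real.exp (ηbar * δ * (y - m)) := by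
    rw [← Real.exp_add, clampedLoss_sub, hE, hδ]
    congr 1
    ring
  simp_rw [hpt]
  rw [← ofReal_integral_eq_lintegral_ofReal (hint.const_mul _)
    (Eventually.of_forall fun y => by positivity), ENNReal.ofReal_le_one, integral_const_mul]
  calc Real.exp (-ηbar * E) * ∫ y, Real.exp (ηbar * δ * (y - m)) ∂(P.condKernel x)
      ≤ Real.exp (-ηbar * E) * Real.exp (c * (ηbar * δ) ^ 2) := by
        gcongr
        exact hle.trans (by linarith [Real.add_one_le_exp (c * (ηbar * δ) ^ 2)])
    _ = Real.exp (-ηbar * E + c * (ηbar * δ) ^ 2) := (Real.exp_add _ _).symm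
    _ ≤ 1 := by
        rw [Real.exp_le_one_iff]
        have h1 : c * (ηbar * δ) ^ 2 ≤ ηbar * (κ * δ ^ 2) := by
          have := mul_le_mul_of_nonneg_right hηκ (mul_nonneg hpos.le (sq_nonneg δ))
          nlinarith
        nlinarith [mul_le_mul_of_nonneg_left hEδ hpos.le]

/-- Upper bound of order `log n / n` on the expected information complexity. -/
lemma exists_expectedBayesIC_clampedLoss_le (hQ : G.family.ClampedBounds a b κ L)
    (h2 : Condition2 P) (π : G.HierPrior) {f₀ : G.Label} (hf₀ : f₀ ∈ G.predictors)
    (hderiv : ∃ C : ℝ, ∀ β ∈ G.param f₀.1, ∀ x : 𝒳,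
      DifferentiableAt ℝ (fun b => G.condMean f₀.1 b x) β ∧
      ‖fderiv ℝ (fun b => G.condMean f₀.1 b x) β‖ ≤ C) {η : ℝ} (hη : 0 < η) :
    ∃ A B : ℝ, 0 ≤ B ∧ ∀ n : ℕ, 1 ≤ n →
      expectedBayesIC P (G.clampedLoss a b) π.measure η f₀ n ≤ 1 / n * (A + B * Real.log n) := by
  obtain ⟨j, β₀⟩ := f₀
  obtain ⟨C, hC⟩ := hderiv
  obtain ⟨R, p, hR, hp, hball⟩ := exists_prior_ball_ge π j hf₀
  have hL := hQ.L_pos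
  set I := ∫ z : 𝒳 × ℝ, L * (L + |z.2|) ∂P with hI
  -- The ball has radius `R / n`. `A` collects the loss variation on it and the constant of its
  -- prior mass; `B` comes from the factor `n ^ (-dim)` of that mass.
  refine ⟨|C| * R * I + -Real.log p / η, G.dim j / η, by positivity, fun n hn => ?_⟩
  have hn0 : (0 : ℝ) < n := by exact_mod_cast hn
  have hn1 : (1 : ℝ) ≤ n := by exact_mod_cast hn
  have hmain := expectedBayesIC_le (P := P) (prior := π.measure) (n := n)
    (measurable_clampedLoss hQ) hη hn (integrable_envelope (L := L) h2 L)
    (fun f z => abs_clampedLoss_sub_le_envelope hQ f ⟨j, β₀⟩ z)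
    (B := Sigma.mk j '' (G.param j ∩ Metric.closedBall β₀ (R * (n : ℝ)⁻¹)))
    ((measurableEmbedding_sigmaMk j).measurableSet_image.mpr
      ((G.measurableSet_param j).inter measurableSet_closedBall))
    (ε := |C| * (R * (n : ℝ)⁻¹)) (p := p * (n : ℝ)⁻¹ ^ G.dim j) (by positivity)
    (hball _ (by positivity) (inv_le_one_of_one_le₀ hn1)) ?_
  · refine hmain.trans_eq ?_
    rw [Real.log_mul hp.ne' (by positivity), Real.log_pow, Real.log_inv, ← hI]
    field_simp
    ring
  · rintro _ ⟨β, ⟨hβ, hβR⟩, rfl⟩ z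
    -- Mean value inequality along segments of the convex parameter set.
    have hlip : |G.condMean j β z.1 - G.condMean j β₀ z.1| ≤ |C| * (R * (n : ℝ)⁻¹) := by
      have := (G.convex_param j).norm_image_sub_le_of_norm_fderiv_le
        (f := fun b => G.condMean j b z.1) (fun β hβ => (hC β hβ z.1).1)
        (fun β hβ => ((hC β hβ z.1).2).trans (le_abs_self C)) hf₀ hβ
      refine this.trans ?_
      gcongr
      exact mem_closedBall_iff_norm.mp hβR
    refine (abs_clampedLoss_sub_le hQ _ _ z).trans ?_
    rw [← mul_assoc, mul_comm _ L]
    gcongr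
    exact (hQ.abs_sub_le _ _).trans (mul_le_mul_of_nonneg_left hlip hL.le)

end GLMSequence

end GLMIC

/-! ### The proposition -/

theorem mainTheorem8 {D : ℕ∞} {𝒳 : Set (GLMIC.Coord D → ℝ)} {M : ℕ∞}
    (G : GLMIC.GLMSequence D 𝒳 M) (hnested : G.IsNested)
    (P : Measure (𝒳 × ℝ)) [IsProbabilityMeasure P]
    (h1 : G.Condition1) (h2 : GLMIC.Condition2 P) (h3 : G.Condition3 P)
    (π : G.HierPrior) :
    (∃ f₀, GLMIC.IsOptimal P G.loss G.predictors f₀) ∧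
    (∃ ηbar : ℝ, 0 < ηbar ∧ GLMIC.CentralCondition P G.loss G.predictors ηbar) ∧
    ∀ f₀, GLMIC.IsOptimal P G.loss G.predictors f₀ → ∀ η : ℝ, 0 < η →
      (∀ n : ℕ, 1 ≤ n → GLMIC.BayesICWellDefined P G.loss π.measure η f₀ n) ∧
      GLMIC.IsSoftO (fun n => max (GLMIC.expectedBayesIC P G.loss π.measure η f₀ n) 0)
        (fun n => 1 / (n : ℝ)) ∧
      ∀ ηbar : ℝ, GLMIC.CentralCondition P G.loss G.predictors ηbar → η ≤ ηbar →
        GLMIC.IsSoftO (fun n => GLMIC.expectedBayesIC P G.loss π.measure η f₀ n)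
          (fun n => 1 / (n : ℝ)) := by
  obtain ⟨-, hderiv, a, b, hab, hmean, hm⟩ := h1
  obtain ⟨κ, L, hQ⟩ := G.family.exists_clampedBounds hab hmean
  obtain ⟨j, β, hβ, hwell⟩ := h3
  have hloss (f) (hf : f ∈ G.predictors) : G.loss f = G.clampedLoss a b f :=
    GLMIC.GLMSequence.loss_eq_clampedLoss hm hf
  have hwm : ∀ x, G.condMean j β x ∈ Set.Icc a b := hm j β hβ
  refine ⟨⟨⟨j, β⟩, hβ, fun f hf => ?_⟩, ?_, fun f₀ hopt η hη => ?_⟩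
  · rw [hloss f hf, hloss ⟨j, β⟩ hβ]
    exact ⟨GLMIC.GLMSequence.integrable_clampedLoss_sub hQ h2 _ _,
      GLMIC.GLMSequence.integral_clampedLoss_sub_nonneg hQ h2 hwm hwell f⟩
  · obtain ⟨ηbar, hpos, hc⟩ := GLMIC.GLMSequence.exists_central_clampedLoss hQ h2
      (f₀ := ⟨j, β⟩) hwm hwell
    refine ⟨ηbar, hpos, ⟨j, β⟩, hβ, fun f hf => ?_⟩
    rw [hloss f hf, hloss ⟨j, β⟩ hβ]
    exact hc f
  have hmeas := GLMIC.GLMSequence.measurable_clampedLoss (a := a) (b := b) hQ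
  have henv := GLMIC.GLMSequence.integrable_envelope (L := L) h2 L
  have hbd := GLMIC.GLMSequence.abs_clampedLoss_sub_le_envelope hQ
  have hae : ∀ᵐ f ∂π.measure, G.loss f = G.clampedLoss a b f :=
    (GLMIC.GLMSequence.ae_mem_predictors π).mono hloss
  have h₀ := hloss f₀ hopt.1
  obtain ⟨A, B, hB, hupper⟩ := GLMIC.GLMSequence.exists_expectedBayesIC_clampedLoss_le hQ h2 π
    hopt.1 (hderiv f₀.1) hη
  -- With `|A|` in place of `A` the bound is nonnegative, so it also dominates the maximum with `0`.
  have hupper' (n : ℕ) (hn : 1 ≤ n) :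
      max (GLMIC.expectedBayesIC P G.loss π.measure η f₀ n) 0 ≤
        1 / n * (|A| + B * Real.log n) := by
    have hlog : 0 ≤ Real.log n := Real.log_nonneg (by exact_mod_cast hn)
    rw [GLMIC.expectedBayesIC_congr hae h₀]
    refine max_le ((hupper n hn).trans ?_) (by positivity)
    gcongr
    exact le_abs_self A
  refine ⟨fun n hn => GLMIC.bayesICWellDefined_congr hae h₀
      (GLMIC.bayesICWellDefined_of_bound hmeas hη hn henv fun f z => hbd f f₀ z),
    GLMIC.isSoftO_of_le (fun n _ => le_max_right _ _) hupper', fun ηbar hcc hle => ?_⟩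
  obtain ⟨f₁, hf₁, hc⟩ := hcc
  refine GLMIC.isSoftO_of_le (fun n hn => ?_) fun n hn => (le_max_left _ _).trans (hupper' n hn)
  -- The central condition may hold with a comparator `f₁` other than `f₀`. Optimality of `f₀` gives
  -- `f₁` at least its risk, so nonnegativity of the complexity relative to `f₁` carries over to
  -- `f₀`.
  have hdiff := (hopt.2 f₁ hf₁).2
  rw [hloss f₁ hf₁, h₀] at hdiff
  rw [GLMIC.expectedBayesIC_congr hae h₀, GLMIC.expectedBayesIC_sub hmeas hη hn henv henv
    (fun f z => hbd f f₀ z) (fun f z => hbd f f₁ z)]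
  refine add_nonneg (GLMIC.expectedBayesIC_nonneg hmeas hη hn henv (fun f z => hbd f f₁ z) hle
    ((GLMIC.GLMSequence.ae_mem_predictors π).mono fun f hf => ?_)) hdiff
  have := hc f hf
  rwa [hloss f hf, hloss f₁ hf₁] at this
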